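/- **Setting.** There are $N$ generators. Generator $i$ has cost $C_i(p)=a_i+b_ip+c_ip^2$ with $c_i>0$ and capacity limits $P_i^{\min},P_i^{\max}$. For $\delta>0$ let $$C_i^\delta(p)=C_i(p)-\delta\big(\ln(p-P_i^{\min})+\ln(P_i^{\max}-p)\big),\qquad \tilde w_i(p)=b_i+2c_ip-\frac{\delta}{p-P_i^{\min}}+\frac{\delta}{P_i^{\max}-p},$$ and write $\tilde w_i$ for $\tilde w_i(P_i)$. For a demand $P_D$ let $\mathcal F$ be the set of $P\in\mathbb R^N$ with $P_i^{\min}<P_i<P_i^{\max}$ for all $i$ and $\sum_iP_i=P_D$; assume $\mathcal F\ne\emptyset$. The modified dispatch problem is to minimize $\sum_iC_i^\delta(P_i)$ over $\mathcal F$. Let $G_1,\dots,G_M$ be connected undirected graphs on the $N$ generators, and let $s$ be a switching signal, i.e. a right-continuous, piecewise constant map $[0,\infty)\to\{1,\dots,M\}$ with finitely many switches in every bounded interval. Let $\beta_{ij}=\beta_{ji}>0$. The adaptive protocol over the switching topology is $$\dot P_i=\sum_{j\in N_i(t)}a_{ij}(t)(\tilde w_j-\tilde w_i),\qquad \dot a_{ij}=\beta_{ij}(\tilde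 w_i-\tilde w_j)^2\ \ (j\in N_i(t)),\qquad \dot a_{ij}=0\ \ (j\notin N_i(t)),$$ where $N_i(t)$ is the set of neighbours of $i$ in $G_{s(t)}$; solutions are continuous and satisfy the equations with right derivatives at every $t\ge0$. Initial data are *admissible* if $P(0)\in\mathcal F$, $a_{ij}(0)=a_{ji}(0)$, and $a_{ij}(0)>0$ for every link $ij$ of every $G_k$; *admissible weights* are weights with these last two properties. Let $\hat e_i=\tilde w_i-\frac1N\sum_j\tilde w_j$, and let $L_{G_k}$ be the Laplacian matrix of $G_k$. **Theorem 4.** The modified dispatch problem has a unique solution $P^*$, and: 1. For every switching signal and all admissible initial data the protocol has a unique solution on $[0,\infty)$. 2. Along every such solution, $P(t)\in\mathcal F$ for all $t\ge0$ (capacity limits and supply-demand balance always hold), $\tilde w_i-\tilde w_j\to0$ for all $i,j$, $P(t)\to P^*$, and the weights $a_{ij}(t)$ converge to admissible weights. 3. For all admissible weights $a^*$, the equilibrium $(P^*,a^*)$ is Lyapunov stable with respect to admissible initial data, uniformly in the switching signal. 4. The consensus error is exponentially stable: for all $\mu,\alpha>0$ there are $K,r>0$ with $\|\hat e(t)\|\le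 Ke^{-rt}\|\hat e(0)\|$ for all $t\ge0$, all switching signals and all solutions with admissible initial data such that $P_i^{\min}+\mu\le P_i(0)\le P_i^{\max}-\mu$ for all $i$ and $a_{ij}(0)\ge\alpha$ on all links of all $G_k$. 5. There is a common Lyapunov function for all modes: for all $\gamma,\theta_0>0$ and $\theta_{ij}=\theta_{ji}$ with $\theta_{ij}\ge\theta_0$ on all links of all $G_k$, the function $$V(P,a)=\gamma\sum_i\big(C_i^\delta(P_i)-C_i^\delta(P_i^*)\big)+\sum_{(i,j)}\frac{\gamma}{4\beta_{ij}}(\theta_{ij}-a_{ij})^2,$$ where the second sum is over the ordered pairs $(i,j)$ that are linked in some $G_k$, is nonnegative for $P\in\mathcal F$, vanishes there exactly when $P=P^*$ and $a_{ij}=\theta_{ij}$ on all these links, and along every solution with admissible initial data its right derivative satisfies $\dot V\le-\gamma\theta_0\,\hat e^TL_{G_{s(t)}}\hat e\le0$ for all $t\ge0$. -/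

import Mathlib

open Set Filter Topology

noncomputable section

/-- Data of one generating unit: the coefficients of its quadratic cost
`a + b * p + c * p ^ 2` and its capacity limits. -/
structure Generator where
  a : ℝ
  b : ℝ
  c : ℝ
  pmin : ℝ
  pmax : ℝ

/-- The cost of a generator, modified by a logarithmic barrier with parameter `δ`.
It is only used for outputs strictly between the capacity limits. -/
def Generator.barrierCost (g : Generator) (δ p : ℝ) : ℝ :=
  g.a + g.b * p + g.c * p ^ 2 - δ * (Real.log (p - g.pmin) + Real.log (g.pmax - p))

/-- The modified incremental cost. -/
def Generator.incrementalCost (g : Generator) (δ p : ℝ) : ℝ :=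
  g.b + 2 * g.c * p - δ / (p - g.pmin) + δ / (g.pmax - p)

/-- Within the capacity limits, the modified incremental cost is the derivative of the
barrier-modified cost. -/
theorem Generator.hasDerivAt_barrierCost (g : Generator) (δ : ℝ) {p : ℝ}
    (h₁ : g.pmin < p) (h₂ : p < g.pmax) :
    HasDerivAt (g.barrierCost δ) (g.incrementalCost δ p) p := by
  have e₁ : p - g.pmin ≠ 0 := (sub_pos.2 h₁).ne'
  have e₂ : g.pmax - p ≠ 0 := (sub_pos.2 h₂).ne'
  have d₁ := ((hasDerivAt_id p).sub_const g.pmin).log e₁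
  have d₂ := ((hasDerivAt_id p).const_sub g.pmax).log e₂
  have d₃ := (((hasDerivAt_id p).const_mul g.b).const_add g.a).add
    (((hasDerivAt_id p).pow 2).const_mul g.c)
  have d := d₃.sub ((d₁.add d₂).const_mul δ)
  refine (d.congr_deriv ?_)
  simp [Generator.incrementalCost]
  ring

variable {N M : ℕ}

/-- The dispatches that lie strictly within the capacity limits (the domain of the barrier)
and meet the demand `D`. -/
def dispatchSet (gen : Fin N → Generator) (D : ℝ) : Set (Fin N → ℝ) :=
  {P | (∀ i, (gen i).pmin < P i ∧ P i < (gen i).pmax) ∧ ∑ i, P i = D}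

/-- `P` solves the barrier-modified economic dispatch problem: it minimizes the total
barrier-modified cost among the dispatches that meet the demand. -/
def IsOptimalDispatch (gen : Fin N → Generator) (δ D : ℝ) (P : Fin N → ℝ) : Prop :=
  P ∈ dispatchSet gen D ∧
    IsMinOn (fun Q : Fin N → ℝ => ∑ i, (gen i).barrierCost δ (Q i)) (dispatchSet gen D) P

/-- The vector of modified incremental costs. -/
def incCost (gen : Fin N → Generator) (δ : ℝ) (P : Fin N → ℝ) (i : Fin N) : ℝ :=
  (gen i).incrementalCost δ (P i)

/-- The consensus error: the deviation of the modified incremental costs from their average. -/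
def consensusError (gen : Fin N → Generator) (δ : ℝ) (P : Fin N → ℝ) (i : Fin N) : ℝ :=
  incCost gen δ P i - (∑ j, incCost gen δ P j) / N

/-- A switching signal on `[0, ∞)` with values in a finite set of modes: right-continuous and
piecewise constant, with finitely many switches in every bounded interval (equivalently, by
compactness: locally constant to the right of each time and to the left of each time). -/
def IsSwitchingSignal (s : ℝ → Fin M) : Prop :=
  (∀ t, 0 ≤ t → ∀ᶠ τ in 𝓝[>] t, s τ = s t) ∧
    ∀ t, 0 < t → ∃ k, ∀ᶠ τ in 𝓝[<] t, s τ = k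

/-- Coupling weights that are symmetric and positive on every link of every graph. -/
def AdmissibleWeights (G : Fin M → SimpleGraph (Fin N)) (A : Fin N → Fin N → ℝ) : Prop :=
  (∀ i j, A i j = A j i) ∧ ∀ k i j, (G k).Adj i j → 0 < A i j

open Classical in
/-- `(P, A)` is a solution on `[0, ∞)` of the adaptive protocol over the switching topology
`t ↦ G (s t)`. Only the links of the current graph are used and adapted; the stored weight of a
link that is down is held. Both are continuous, and the differential equations hold for right
derivatives at every time, hence in the usual sense between switches. -/
structure IsProtocolSolution (gen : Fin N → Generator) (δ : ℝ) (β : Fin N → Fin N → ℝ)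
    (G : Fin M → SimpleGraph (Fin N)) (s : ℝ → Fin M)
    (P : ℝ → Fin N → ℝ) (A : ℝ → Fin N → Fin N → ℝ) : Prop where
  continuousOn_power : ∀ i, ContinuousOn (fun t => P t i) (Ici 0)
  continuousOn_weight : ∀ i j, ContinuousOn (fun t => A t i j) (Ici 0)
  power_deriv : ∀ t, 0 ≤ t → ∀ i, HasDerivWithinAt (fun τ => P τ i)
    (∑ j, if (G (s t)).Adj i j then
      A t i j * (incCost gen δ (P t) j - incCost gen δ (P t) i) else 0) (Ici t) t
  weight_deriv : ∀ t, 0 ≤ t → ∀ i j, HasDerivWithinAt (fun τ => A τ i j)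
    (if (G (s t)).Adj i j then
      β i j * (incCost gen δ (P t) i - incCost gen δ (P t) j) ^ 2 else 0) (Ici t) t

open Classical in
/-- The quadratic form `eᵀ L e` of the Laplacian `L` of a graph. -/
def laplacianForm (H : SimpleGraph (Fin N)) (e : Fin N → ℝ) : ℝ :=
  e ⬝ᵥ (H.lapMatrix ℝ).mulVec e

open Classical in
/-- The energy of a state `(P, A)` relative to the dispatch `Q` and the target weights `θ`: the
excess of the total barrier-modified cost plus the weighted squared deviation of the weights
over the links that occur in some graph of the family, scaled by `γ`. -/
def energy (gen : Fin N → Generator) (δ : ℝ) (β : Fin N → Fin N → ℝ)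
    (G : Fin M → SimpleGraph (Fin N)) (γ : ℝ) (θ : Fin N → Fin N → ℝ) (Q : Fin N → ℝ)
    (P : Fin N → ℝ) (A : Fin N → Fin N → ℝ) : ℝ :=
  γ * ∑ i, ((gen i).barrierCost δ (P i) - (gen i).barrierCost δ (Q i)) +
    ∑ i, ∑ j, if ∃ k, (G k).Adj i j then γ / (4 * β i j) * (θ i j - A i j) ^ 2 else 0

end

/-! ### The barrier-modified cost of one generator -/

/-! The total modified cost is strongly convex, and the barrier forces every sublevel set to keep a
positive distance from the capacity limits (`exists_margin_of_totalCost_le`). Hence a minimizer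
exists by compactness. It is unique by quadratic growth, and all incremental costs agree there.

Along the protocol, symmetric coupling conserves total power, and the cost has derivative `-1/2`
times the link sum of `a_ij (w_i - w_j)^2`. Weights never decrease, so the cost never increases, and
the trajectory keeps the margin enforced by its initial cost. A solution is not assumed to respect
the limits; this follows by an invariance argument (`mem_of_invariance`).

For convergence, strong convexity bounds the excess cost by the squared consensus error
(`IsOptimalDispatch.excess_le`), and a Poincaré inequality valid for all the graphs
(`exists_poincare`) bounds that error by the link sum in the dissipation. The excess therefore
decays exponentially whatever the switching (`exists_exponential_decay`). Inside the margin the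
excess is comparable to the squared consensus error, so the error decays as well.

The energy adds a quadratic penalty on the weights, scaled so that the current weights cancel from
its derivative and only the targets `θ` remain (`energy_deriv`). It is thus a Lyapunov function
common to all modes. It bounds the weights, which converge by monotonicity, and it gives Lyapunov
stability.

Global existence comes from a clipped vector field that is bounded and Lipschitz: its solutions are
continued across switches, and the a priori bounds show that the clipping is never active. -/

theorem Real.log_sub_log_le {x y : ℝ} (hx : 0 < x) (hy : 0 < y) :
    Real.log x - Real.log y ≤ (x - y) / y := by
  have h := Real.log_le_sub_one_of_pos (div_pos hx hy)
  rw [Real.log_div hx.ne' hy.ne'] at h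
  rwa [sub_div, div_self hy.ne']

namespace Generator

/-- The quadratic part of the cost contributes exactly `c (p - q)^2`. The barrier is convex, so it
lies above its tangents; this is the tangent inequality for `log`. -/
theorem barrierCost_strongly_convex (g : Generator) {δ p q : ℝ} (hδ : 0 < δ)
    (hp : g.pmin < p ∧ p < g.pmax) (hq : g.pmin < q ∧ q < g.pmax) :
    g.incrementalCost δ q * (p - q) + g.c * (p - q) ^ 2 ≤
      g.barrierCost δ p - g.barrierCost δ q := by
  have h₁ := mul_le_mul_of_nonneg_left
    (Real.log_sub_log_le (sub_pos.2 hp.1) (sub_pos.2 hq.1)) hδ.le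
  have h₂ := mul_le_mul_of_nonneg_left
    (Real.log_sub_log_le (sub_pos.2 hp.2) (sub_pos.2 hq.2)) hδ.le
  have e₁ : δ * ((p - g.pmin - (q - g.pmin)) / (q - g.pmin)) =
      δ / (q - g.pmin) * (p - q) := by ring
  have e₂ : δ * ((g.pmax - p - (g.pmax - q)) / (g.pmax - q)) =
      - (δ / (g.pmax - q) * (p - q)) := by ring
  rw [e₁] at h₁
  rw [e₂] at h₂
  unfold incrementalCost barrierCost
  nlinarith [h₁, h₂]

/-- A lower bound for the modified cost within the capacity limits. -/
noncomputable def costFloor (g : Generator) (δ : ℝ) : ℝ :=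
  g.a - g.b ^ 2 / (4 * g.c) - 2 * δ * (g.pmax - g.pmin)

theorem quadratic_lower_bound (g : Generator) (hc : 0 < g.c) (p : ℝ) :
    g.a - g.b ^ 2 / (4 * g.c) ≤ g.a + g.b * p + g.c * p ^ 2 := by
  have : 0 ≤ g.c * (p + g.b / (2 * g.c)) ^ 2 := by positivity
  have e : g.c * (p + g.b / (2 * g.c)) ^ 2 = g.c * p ^ 2 + g.b * p + g.b ^ 2 / (4 * g.c) := by
    field_simp
    ring
  linarith

/-- Each logarithm is at most the width of the capacity interval. Estimating one or both of them
this way leaves the other barrier term, or only the floor. -/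
theorem barrierCost_lower_bounds (g : Generator) {δ p : ℝ} (hc : 0 < g.c) (hδ : 0 < δ)
    (h₁ : g.pmin < p) (h₂ : p < g.pmax) :
    g.costFloor δ ≤ g.barrierCost δ p ∧
      g.costFloor δ - δ * Real.log (p - g.pmin) ≤ g.barrierCost δ p ∧
      g.costFloor δ - δ * Real.log (g.pmax - p) ≤ g.barrierCost δ p := by
  have hq := g.quadratic_lower_bound hc p
  have l₁ : Real.log (p - g.pmin) ≤ g.pmax - g.pmin := by
    have := Real.log_le_sub_one_of_pos (sub_pos.2 h₁)
    linarith
  have l₂ : Real.log (g.pmax - p) ≤ g.pmax - g.pmin := by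
    have := Real.log_le_sub_one_of_pos (sub_pos.2 h₂)
    linarith
  have w : 0 < δ * (g.pmax - g.pmin) := mul_pos hδ (by linarith)
  have m₁ := mul_le_mul_of_nonneg_left l₁ hδ.le
  have m₂ := mul_le_mul_of_nonneg_left l₂ hδ.le
  unfold costFloor barrierCost
  refine ⟨?_, ?_, ?_⟩ <;> nlinarith

theorem abs_inv_sub_inv_le {m x y : ℝ} (hm : 0 < m) (hx : m ≤ x) (hy : m ≤ y) :
    |1 / x - 1 / y| ≤ 1 / m ^ 2 * |x - y| := by
  have hx' : 0 < x := hm.trans_le hx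
  have hy' : 0 < y := hm.trans_le hy
  have e : 1 / x - 1 / y = 1 / (x * y) * (y - x) := by field_simp
  rw [e, abs_mul, abs_sub_comm y x, abs_of_pos (by positivity)]
  gcongr
  nlinarith

/-- The Lipschitz constant of the modified incremental cost at distance `m` from the limits. -/
noncomputable def slopeBound (g : Generator) (δ m : ℝ) : ℝ := 2 * g.c + 2 * (δ / m ^ 2)

theorem slopeBound_pos (g : Generator) {δ m : ℝ} (hc : 0 < g.c) (hδ : 0 < δ) :
    0 < g.slopeBound δ m := by
  unfold slopeBound
  positivity

theorem abs_incrementalCost_sub_le (g : Generator) {δ m p q : ℝ} (hc : 0 < g.c) (hδ : 0 < δ)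
    (hm : 0 < m) (hp : g.pmin + m ≤ p ∧ p ≤ g.pmax - m) (hq : g.pmin + m ≤ q ∧ q ≤ g.pmax - m) :
    |g.incrementalCost δ p - g.incrementalCost δ q| ≤ g.slopeBound δ m * |p - q| := by
  have h₁ := abs_inv_sub_inv_le hm (x := p - g.pmin) (y := q - g.pmin) (by linarith) (by linarith)
  have h₂ := abs_inv_sub_inv_le hm (x := g.pmax - p) (y := g.pmax - q) (by linarith) (by linarith)
  rw [show p - g.pmin - (q - g.pmin) = p - q by ring] at h₁
  rw [show g.pmax - p - (g.pmax - q) = q - p by ring, abs_sub_comm q p] at h₂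
  have e : g.incrementalCost δ p - g.incrementalCost δ q = 2 * g.c * (p - q) -
      δ * (1 / (p - g.pmin) - 1 / (q - g.pmin)) + δ * (1 / (g.pmax - p) - 1 / (g.pmax - q)) := by
    unfold incrementalCost
    ring
  rw [e]
  calc _ ≤ |2 * g.c * (p - q)| + |δ * (1 / (p - g.pmin) - 1 / (q - g.pmin))| +
        |δ * (1 / (g.pmax - p) - 1 / (g.pmax - q))| :=
      (abs_add_le _ _).trans (by gcongr; exact abs_sub _ _)
    _ ≤ 2 * g.c * |p - q| + δ * (1 / m ^ 2 * |p - q|) + δ * (1 / m ^ 2 * |p - q|) := by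
      rw [abs_mul, abs_mul δ, abs_mul δ, abs_of_pos hδ, abs_of_pos (by positivity : 0 < 2 * g.c)]
      gcongr
    _ = _ := by unfold slopeBound; ring

theorem continuousAt_barrierCost (g : Generator) (δ : ℝ) {p : ℝ}
    (hp : g.pmin < p ∧ p < g.pmax) : ContinuousAt (g.barrierCost δ) p :=
  (g.hasDerivAt_barrierCost δ hp.1 hp.2).continuousAt

end Generator

/-! ### The dispatch problem -/

/-- The total modified cost of a dispatch. -/
noncomputable def totalCost (gen : Fin N → Generator) (δ : ℝ) (P : Fin N → ℝ) : ℝ :=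
  ∑ i, (gen i).barrierCost δ (P i)

/-- Strict feasibility with respect to the capacity limits. -/
def WithinLimits (gen : Fin N → Generator) (P : Fin N → ℝ) : Prop :=
  ∀ i, (gen i).pmin < P i ∧ P i < (gen i).pmax

/-- Feasibility with a margin `m` with respect to the capacity limits. -/
def WithinMargin (gen : Fin N → Generator) (m : ℝ) (P : Fin N → ℝ) : Prop :=
  ∀ i, (gen i).pmin + m ≤ P i ∧ P i ≤ (gen i).pmax - m

section Dispatch

variable {gen : Fin N → Generator} {δ D : ℝ}

theorem WithinMargin.withinLimits {m : ℝ} (hm : 0 < m) {P : Fin N → ℝ}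
    (h : WithinMargin gen m P) : WithinLimits gen P :=
  fun i => ⟨by linarith [(h i).1], by linarith [(h i).2]⟩

theorem WithinMargin.mono {m m' : ℝ} (hm : m' ≤ m) {P : Fin N → ℝ}
    (h : WithinMargin gen m P) : WithinMargin gen m' P :=
  fun i => ⟨by linarith [(h i).1], by linarith [(h i).2]⟩

/-- All other generators cost at least their floor, so a bound on the total bounds the cost of each
single one, and its barrier then keeps it off its limits. The margin depends on `E` alone, which
makes later constants uniform over solutions. -/
theorem exists_margin_of_totalCost_le (gen : Fin N → Generator) (hc : ∀ i, 0 < (gen i).c)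
    (hδ : 0 < δ) (E : ℝ) :
    ∃ m, 0 < m ∧ ∀ P, WithinLimits gen P → totalCost gen δ P ≤ E → WithinMargin gen m P := by
  set S : ℝ := ∑ i, (gen i).costFloor δ with hS
  -- This is the `x` at which the barrier term `-δ log x` equals `E - S`, the largest possible
  -- excess over the floor.
  refine ⟨Real.exp (-(E - S) / δ), Real.exp_pos _, fun P hP hE i => ?_⟩
  have hb := fun j => (gen j).barrierCost_lower_bounds (hc j) hδ (hP j).1 (hP j).2
  have hi : (gen i).barrierCost δ (P i) - (gen i).costFloor δ ≤ E - S := by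
    have h := Finset.single_le_sum
      (f := fun j => (gen j).barrierCost δ (P j) - (gen j).costFloor δ) (s := Finset.univ)
      (fun j _ => sub_nonneg.2 (hb j).1) (Finset.mem_univ i)
    rw [Finset.sum_sub_distrib] at h
    unfold totalCost at hE
    linarith
  have key : ∀ x : ℝ, 0 < x → (gen i).costFloor δ - δ * Real.log x ≤ (gen i).barrierCost δ (P i) →
      Real.exp (-(E - S) / δ) ≤ x := by
    intro x hx h
    rw [← Real.le_log_iff_exp_le hx, div_le_iff₀ hδ]
    linarith
  exact ⟨by linarith [key _ (sub_pos.2 (hP i).1) (hb i).2.1],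
    by linarith [key _ (sub_pos.2 (hP i).2) (hb i).2.2]⟩

theorem continuousAt_totalCost {P : Fin N → ℝ} (hP : WithinLimits gen P) :
    ContinuousAt (totalCost gen δ) P := by
  unfold totalCost
  refine tendsto_finsetSum _ fun i _ => ?_
  exact ((gen i).continuousAt_barrierCost δ (hP i)).comp (f := fun P : Fin N → ℝ => P i)
    (continuousAt_apply i P)

/-- The feasible set is not closed, so the minimum is taken over the compact set with the margin of
a reference dispatch `P₀`. Any dispatch costing more than `P₀` is beaten by `P₀` itself. -/
theorem exists_isOptimalDispatch (hc : ∀ i, 0 < (gen i).c) (hδ : 0 < δ)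
    (hD : (dispatchSet gen D).Nonempty) : ∃ Q, IsOptimalDispatch gen δ D Q := by
  obtain ⟨P₀, hP₀⟩ := hD
  obtain ⟨m, hm, hmE⟩ := exists_margin_of_totalCost_le gen hc hδ (totalCost gen δ P₀)
  set K : Set (Fin N → ℝ) := {P | WithinMargin gen m P ∧ ∑ i, P i = D} with hK
  have hKc : IsCompact K := by
    have h₁ : IsCompact (Set.pi univ fun i => Icc ((gen i).pmin + m) ((gen i).pmax - m)) :=
      isCompact_univ_pi fun i => isCompact_Icc
    have h₂ : IsClosed {P : Fin N → ℝ | ∑ i, P i = D} :=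
      isClosed_eq (continuous_finsetSum _ fun i _ => continuous_apply i) continuous_const
    convert h₁.inter_right h₂ using 1
    ext P
    simp only [hK, WithinMargin, mem_ofPred_eq, mem_inter_iff, mem_univ_pi, mem_Icc]
  have hcont : ContinuousOn (totalCost gen δ) K := fun P hP =>
    (continuousAt_totalCost (hP.1.withinLimits hm)).continuousWithinAt
  obtain ⟨Q, hQ, hmin⟩ := hKc.exists_isMinOn ⟨P₀, hmE _ hP₀.1 le_rfl, hP₀.2⟩ hcont
  refine ⟨Q, ⟨hQ.1.withinLimits hm, hQ.2⟩, fun P hP => ?_⟩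
  change totalCost gen δ Q ≤ totalCost gen δ P
  rcases le_total (totalCost gen δ P) (totalCost gen δ P₀) with h | h
  · exact hmin (show P ∈ K from ⟨hmE _ hP.1 h, hP.2⟩)
  · exact le_trans (hmin (show P₀ ∈ K from ⟨hmE _ hP₀.1 le_rfl, hP₀.2⟩)) h

/-- At an optimal dispatch, the modified incremental costs are orthogonal to all
redistributions of power. -/
theorem IsOptimalDispatch.sum_incCost_mul_eq_zero {Q : Fin N → ℝ}
    (hQ : IsOptimalDispatch gen δ D Q) {d : Fin N → ℝ} (hd : ∑ i, d i = 0) :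
    ∑ i, incCost gen δ Q i * d i = 0 := by
  have hderiv : HasDerivAt (fun h : ℝ => ∑ i, (gen i).barrierCost δ (Q i + h * d i))
      (∑ i, incCost gen δ Q i * d i) 0 := by
    refine HasDerivAt.fun_sum fun i _ => ?_
    have h₁ : HasDerivAt (fun h : ℝ => Q i + h * d i) (d i) 0 := by
      simpa using ((hasDerivAt_id (0 : ℝ)).mul_const (d i)).const_add (Q i)
    have h₂ : HasDerivAt ((gen i).barrierCost δ) (incCost gen δ Q i) (Q i + 0 * d i) := by
      rw [zero_mul, add_zero]
      exact (gen i).hasDerivAt_barrierCost δ (hQ.1.1 i).1 (hQ.1.1 i).2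
    exact h₂.comp (0 : ℝ) h₁
  refine IsLocalMin.hasDerivAt_eq_zero ?_ hderiv
  have hev : ∀ᶠ h : ℝ in 𝓝 0, ∀ i, (gen i).pmin < Q i + h * d i ∧ Q i + h * d i < (gen i).pmax := by
    refine eventually_all.2 fun i => ?_
    have hc : Tendsto (fun h : ℝ => Q i + h * d i) (𝓝 0) (𝓝 (Q i)) := by
      have : Continuous fun h : ℝ => Q i + h * d i := by fun_prop
      simpa using this.tendsto 0
    exact hc.eventually (Ioo_mem_nhds (hQ.1.1 i).1 (hQ.1.1 i).2)
  filter_upwards [hev] with h hh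
  have := hQ.2 (show (fun i => Q i + h * d i) ∈ dispatchSet gen D from
    ⟨hh, by rw [Finset.sum_add_distrib, ← Finset.mul_sum, hd, hQ.1.2]; ring⟩)
  simpa using this

/-- The excess cost grows quadratically away from the optimum. -/
theorem IsOptimalDispatch.quadratic_growth {Q P : Fin N → ℝ} (hδ : 0 < δ)
    (hQ : IsOptimalDispatch gen δ D Q) (hP : P ∈ dispatchSet gen D) :
    ∑ i, (gen i).c * (P i - Q i) ^ 2 ≤
      ∑ i, ((gen i).barrierCost δ (P i) - (gen i).barrierCost δ (Q i)) := by
  have h := hQ.sum_incCost_mul_eq_zero (d := fun i => P i - Q i)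
    (by rw [Finset.sum_sub_distrib, hP.2, hQ.1.2, sub_self])
  calc _ = ∑ i, (incCost gen δ Q i * (P i - Q i) + (gen i).c * (P i - Q i) ^ 2) := by
        rw [Finset.sum_add_distrib, h, zero_add]
    _ ≤ _ := Finset.sum_le_sum fun i _ =>
        (gen i).barrierCost_strongly_convex hδ (hP.1 i) (hQ.1.1 i)

theorem IsOptimalDispatch.eq_of_excess_le_zero {Q P : Fin N → ℝ} (hc : ∀ i, 0 < (gen i).c)
    (hδ : 0 < δ) (hQ : IsOptimalDispatch gen δ D Q) (hP : P ∈ dispatchSet gen D)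
    (h : ∑ i, ((gen i).barrierCost δ (P i) - (gen i).barrierCost δ (Q i)) ≤ 0) : P = Q := by
  have h₀ : ∀ i ∈ Finset.univ, 0 ≤ (gen i).c * (P i - Q i) ^ 2 := fun i _ =>
    mul_nonneg (hc i).le (sq_nonneg _)
  have h₁ := (Finset.sum_eq_zero_iff_of_nonneg h₀).1
    (le_antisymm ((hQ.quadratic_growth hδ hP).trans h) (Finset.sum_nonneg h₀))
  funext i
  have h₂ := h₁ i (Finset.mem_univ i)
  have h₃ : (P i - Q i) ^ 2 = 0 := (mul_eq_zero.1 h₂).resolve_left (hc i).ne'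
  exact sub_eq_zero.1 (pow_eq_zero_iff two_ne_zero |>.1 h₃)

theorem IsOptimalDispatch.unique {Q Q' : Fin N → ℝ} (hc : ∀ i, 0 < (gen i).c) (hδ : 0 < δ)
    (hQ : IsOptimalDispatch gen δ D Q) (hQ' : IsOptimalDispatch gen δ D Q') : Q' = Q := by
  refine hQ.eq_of_excess_le_zero hc hδ hQ'.1 ?_
  have := hQ'.2 hQ.1
  simp only [mem_ofPred_eq] at this
  rw [Finset.sum_sub_distrib]
  linarith

/-! ### The excess cost and the consensus error -/

theorem sum_consensusError (gen : Fin N → Generator) (δ : ℝ) (P : Fin N → ℝ) :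
    ∑ i, consensusError gen δ P i = 0 := by
  unfold consensusError
  rcases Nat.eq_zero_or_pos N with rfl | hN
  · simp
  · have : (N : ℝ) ≠ 0 := by exact_mod_cast hN.ne'
    rw [Finset.sum_sub_distrib, Finset.sum_const, Finset.card_univ, Fintype.card_fin, nsmul_eq_mul]
    field_simp
    ring

theorem consensusError_sub (gen : Fin N → Generator) (δ : ℝ) (P : Fin N → ℝ) (i j : Fin N) :
    consensusError gen δ P i - consensusError gen δ P j =
      incCost gen δ P i - incCost gen δ P j := by
  unfold consensusError
  ring

theorem sum_consensusError_mul (gen : Fin N → Generator) (δ : ℝ) (P : Fin N → ℝ)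
    {d : Fin N → ℝ} (hd : ∑ i, d i = 0) :
    ∑ i, consensusError gen δ P i * d i = ∑ i, incCost gen δ P i * d i := by
  unfold consensusError
  simp_rw [sub_mul]
  rw [Finset.sum_sub_distrib, ← Finset.mul_sum, hd, mul_zero, sub_zero]

/-- The average is the best constant approximation in least squares: the cross term vanishes because
the consensus error sums to zero. -/
theorem sum_consensusError_sq_le (gen : Fin N → Generator) (δ : ℝ) (P v : Fin N → ℝ)
    (hv : ∀ i j, v i = v j) :
    ∑ i, consensusError gen δ P i ^ 2 ≤ ∑ i, (incCost gen δ P i - v i) ^ 2 := by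
  have h : ∀ i, (incCost gen δ P i - v i) ^ 2 = consensusError gen δ P i ^ 2 +
      2 * (consensusError gen δ P i * ((∑ j, incCost gen δ P j) / N - v i)) +
      ((∑ j, incCost gen δ P j) / N - v i) ^ 2 := by
    intro i
    unfold consensusError
    ring
  simp_rw [h]
  rw [Finset.sum_add_distrib, Finset.sum_add_distrib, ← Finset.mul_sum]
  have h₀ : ∑ i, consensusError gen δ P i * ((∑ j, incCost gen δ P j) / N - v i) = 0 := by
    rcases isEmpty_or_nonempty (Fin N) with _ | ⟨⟨k⟩⟩
    · simp
    · simp_rw [fun i => hv i k]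
      rw [← Finset.sum_mul, sum_consensusError, zero_mul]
  rw [h₀]
  have : 0 ≤ ∑ i, ((∑ j, incCost gen δ P j) / N - v i) ^ 2 :=
    Finset.sum_nonneg fun i _ => sq_nonneg _
  linarith

theorem IsOptimalDispatch.incCost_eq {Q : Fin N → ℝ} (hQ : IsOptimalDispatch gen δ D Q)
    (i j : Fin N) : incCost gen δ Q i = incCost gen δ Q j := by
  -- Test the first-order condition by shifting one unit of power from `j` to `i`.
  have h := hQ.sum_incCost_mul_eq_zero (d := Pi.single i 1 - Pi.single j 1) (by simp)
  simp only [Pi.sub_apply, mul_sub, Finset.sum_sub_distrib] at h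
  simpa [Pi.single_apply, sub_eq_zero] using h

/-- A Polyak–Łojasiewicz inequality. Strong convexity at `P` bounds the excess by a concave
quadratic in `P - Q`; since `P - Q` sums to zero, the incremental costs in it may be replaced by the
consensus error, and completing the square gives `1 / (4 c₀)`. -/
theorem IsOptimalDispatch.excess_le {Q P : Fin N → ℝ} {c₀ : ℝ} (hδ : 0 < δ) (hc₀ : 0 < c₀)
    (hc : ∀ i, c₀ ≤ (gen i).c)
    (hQ : IsOptimalDispatch gen δ D Q) (hP : P ∈ dispatchSet gen D) :
    ∑ i, ((gen i).barrierCost δ (P i) - (gen i).barrierCost δ (Q i)) ≤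
      1 / (4 * c₀) * ∑ i, consensusError gen δ P i ^ 2 := by
  have hd : ∑ i, (P i - Q i) = 0 := by rw [Finset.sum_sub_distrib, hP.2, hQ.1.2, sub_self]
  have h₁ : ∑ i, ((gen i).barrierCost δ (P i) - (gen i).barrierCost δ (Q i)) ≤
      ∑ i, (incCost gen δ P i * (P i - Q i) - c₀ * (P i - Q i) ^ 2) := by
    refine Finset.sum_le_sum fun i _ => ?_
    have h := (gen i).barrierCost_strongly_convex hδ (hQ.1.1 i) (hP.1 i)
    have h' := mul_le_mul_of_nonneg_right (hc i) (sq_nonneg (P i - Q i))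
    unfold incCost
    nlinarith
  refine h₁.trans ?_
  rw [Finset.sum_sub_distrib, ← sum_consensusError_mul gen δ P hd, ← Finset.sum_sub_distrib,
    Finset.mul_sum]
  refine Finset.sum_le_sum fun i _ => ?_
  have h : 0 ≤ c₀ * (P i - Q i - consensusError gen δ P i / (2 * c₀)) ^ 2 := by positivity
  have e : c₀ * (P i - Q i - consensusError gen δ P i / (2 * c₀)) ^ 2 =
      c₀ * (P i - Q i) ^ 2 - consensusError gen δ P i * (P i - Q i) +
      1 / (4 * c₀) * consensusError gen δ P i ^ 2 := by
    field_simp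
    ring
  linarith

/-- The incremental costs at `Q` form a constant vector, so the error is at most their distance to
it. This is controlled by the Lipschitz bound in the margin and then by quadratic growth. -/
theorem IsOptimalDispatch.sum_consensusError_sq_le {Q P : Fin N → ℝ} {c₀ Λ m : ℝ}
    (hδ : 0 < δ) (hm : 0 < m) (hc₀ : 0 < c₀) (hc : ∀ i, c₀ ≤ (gen i).c)
    (hΛ : ∀ i, (gen i).slopeBound δ m ≤ Λ)
    (hQ : IsOptimalDispatch gen δ D Q) (hP : P ∈ dispatchSet gen D)
    (hQm : WithinMargin gen m Q) (hPm : WithinMargin gen m P) :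
    ∑ i, consensusError gen δ P i ^ 2 ≤ Λ ^ 2 / c₀ *
      ∑ i, ((gen i).barrierCost δ (P i) - (gen i).barrierCost δ (Q i)) := by
  have hpos : ∀ i, 0 < (gen i).c := fun i => hc₀.trans_le (hc i)
  calc _ ≤ ∑ i, (incCost gen δ P i - incCost gen δ Q i) ^ 2 :=
        _root_.sum_consensusError_sq_le gen δ P _ hQ.incCost_eq
    _ ≤ ∑ i, Λ ^ 2 / c₀ * ((gen i).c * (P i - Q i) ^ 2) := by
        refine Finset.sum_le_sum fun i _ => ?_
        have h₁ := (gen i).abs_incrementalCost_sub_le (hpos i) hδ hm (hPm i) (hQm i)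
        have h₂ := h₁.trans (mul_le_mul_of_nonneg_right (hΛ i) (abs_nonneg _))
        have h₃ := pow_le_pow_left₀ (abs_nonneg _) h₂ 2
        rw [mul_pow, sq_abs, sq_abs] at h₃
        refine h₃.trans ?_
        have : Λ ^ 2 / c₀ * ((gen i).c * (P i - Q i) ^ 2) =
          Λ ^ 2 * (P i - Q i) ^ 2 * ((gen i).c / c₀) := by ring
        rw [this]
        exact le_mul_of_one_le_right (by positivity) ((one_le_div hc₀).2 (hc i))
    _ ≤ _ := by
        rw [← Finset.mul_sum]
        exact mul_le_mul_of_nonneg_left (hQ.quadratic_growth hδ hP) (by positivity)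

end Dispatch

/-! ### Differential equations with right derivatives -/

section RightDerivative

theorem le_of_right_deriv_nonpos {f f' : ℝ → ℝ} {a b : ℝ} (hab : a ≤ b)
    (hf : ContinuousOn f (Icc a b))
    (hf' : ∀ x ∈ Ico a b, HasDerivWithinAt f (f' x) (Ici x) x)
    (hneg : ∀ x ∈ Ico a b, f' x ≤ 0) : f b ≤ f a :=
  image_le_of_deriv_right_le_deriv_boundary (B := fun _ => f a) (B' := fun _ => 0) hf hf' le_rfl
    continuousOn_const (fun _ _ => hasDerivWithinAt_const _ _ _) hneg (right_mem_Icc.2 hab)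

theorem exp_decay_of_right_deriv_le {f f' : ℝ → ℝ} {r b : ℝ} (hb : 0 ≤ b)
    (hf : ContinuousOn f (Icc 0 b))
    (hf' : ∀ x ∈ Ico 0 b, HasDerivWithinAt f (f' x) (Ici x) x)
    (hle : ∀ x ∈ Ico 0 b, f' x ≤ -r * f x) : f b ≤ Real.exp (-r * b) * f 0 := by
  have hexp : ∀ x : ℝ, HasDerivAt (fun t => Real.exp (r * t)) (Real.exp (r * x) * r) x := fun x => by
    simpa using ((hasDerivAt_id x).const_mul r).exp
  -- Integrating factor: `exp (r t) f t` is nonincreasing.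
  have h := le_of_right_deriv_nonpos hb (f := fun t => Real.exp (r * t) * f t)
    (f' := fun x => Real.exp (r * x) * r * f x + Real.exp (r * x) * f' x)
    ((by fun_prop : Continuous fun t => Real.exp (r * t)).continuousOn.mul hf)
    (fun x hx => (hexp x).hasDerivWithinAt.mul (hf' x hx))
    (fun x hx => by nlinarith [hle x hx, Real.exp_pos (r * x)])
  simp only [mul_zero, Real.exp_zero, one_mul] at h
  rw [neg_mul, Real.exp_neg, inv_mul_eq_div, le_div_iff₀ (Real.exp_pos _), mul_comm]
  exact h

/-- If a trajectory that has stayed in the open set `U` must be in the closed subset `K`, then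
it stays in `K`. -/
theorem mem_of_invariance {E : Type*} [TopologicalSpace E] {f : ℝ → E} {U K : Set E}
    (hf : ContinuousOn f (Ici 0)) (hU : IsOpen U) (hK : IsClosed K) (hKU : K ⊆ U)
    (h₀ : f 0 ∈ U)
    (h : ∀ T, 0 < T → (∀ t ∈ Ico 0 T, f t ∈ U) → ∀ t ∈ Ico 0 T, f t ∈ K) :
    ∀ t, 0 ≤ t → f t ∈ K := by
  have hright : ∀ t, 0 ≤ t → f t ∈ U → ∃ u > t, ∀ τ ∈ Ico t u, f τ ∈ U := by
    intro t ht hft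
    have h₁ : ∀ᶠ τ in 𝓝[≥] t, f τ ∈ U :=
      ((hf t ht).mono (Ici_subset_Ici.2 ht)).eventually (hU.mem_nhds hft)
    obtain ⟨u, hu, hu'⟩ := mem_nhdsGE_iff_exists_Ico_subset.1 h₁
    exact ⟨u, hu, hu'⟩
  have hall : ∀ t, 0 ≤ t → f t ∈ U := by
    by_contra! hcon
    obtain ⟨t₁, ht₁, hbad⟩ := hcon
    -- The first exit time `T` cannot exist: before `T` the trajectory is in the closed set `K`, so
    -- `f T ∈ K ⊆ U`, and openness of `U` carries it past `T`.
    set B : Set ℝ := {t | 0 ≤ t ∧ f t ∉ U} with hB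
    have hbdd : BddBelow B := ⟨0, fun t ht => ht.1⟩
    have hne : B.Nonempty := ⟨t₁, ht₁, hbad⟩
    set T := sInf B with hT
    have hT₀ : 0 ≤ T := le_csInf hne fun t ht => ht.1
    have hlt : ∀ t ∈ Ico 0 T, f t ∈ U := fun t ht => by
      by_contra hc
      exact not_lt.2 (csInf_le hbdd (show t ∈ B from ⟨ht.1, hc⟩)) ht.2
    have hfT : f T ∈ U := by
      rcases hT₀.eq_or_lt with h0 | hpos
      · rw [← h0]
        exact h₀
      · refine hKU ?_
        have hcl : closure (Ico 0 T) = Icc 0 T := closure_Ico hpos.ne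
        have hmem : T ∈ closure (Ico 0 T) := by
          rw [hcl]
          exact right_mem_Icc.2 hT₀
        have hc : ContinuousWithinAt f (Ico 0 T) T := (hf T hT₀).mono fun x hx => hx.1
        have := hc.mem_closure hmem (h T hpos hlt)
        rwa [hK.closure_eq] at this
    obtain ⟨u, hu, hu'⟩ := hright T hT₀ hfT
    obtain ⟨t, ht, htu⟩ := exists_lt_of_csInf_lt hne hu
    exact ht.2 (hu' t ⟨csInf_le hbdd ht, htu⟩)
  exact fun t ht => h (t + 1) (by linarith) (fun τ hτ => hall τ hτ.1) t ⟨ht, by linarith⟩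

end RightDerivative

/-! ### Existence and uniqueness for switched differential equations -/

section SwitchedODE

variable {E ι : Type*} [NormedAddCommGroup E] [NormedSpace ℝ E] {v : ι → E → E} {s : ℝ → ι}
  {K : NNReal}

/-- `f` solves the switched differential equation `f' = v (s t) f` on `[0, T]`. -/
def IsSwitchedSolution (v : ι → E → E) (s : ℝ → ι) (T : ℝ) (f : ℝ → E) : Prop :=
  ContinuousOn f (Icc 0 T) ∧ ∀ t ∈ Ico 0 T, HasDerivWithinAt f (v (s t) (f t)) (Ici t) t

theorem IsSwitchedSolution.mono {T T' : ℝ} {f : ℝ → E} (h : IsSwitchedSolution v s T f)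
    (hT : T' ≤ T) : IsSwitchedSolution v s T' f :=
  ⟨h.1.mono (Icc_subset_Icc_right hT), fun t ht => h.2 t ⟨ht.1, ht.2.trans_le hT⟩⟩

/-- Grönwall uniqueness needs only right derivatives and a Lipschitz constant common to all modes,
and no regularity of the signal in time. -/
theorem IsSwitchedSolution.eqOn (hK : ∀ k, LipschitzWith K (v k)) {T : ℝ} {f g : ℝ → E}
    (hf : IsSwitchedSolution v s T f) (hg : IsSwitchedSolution v s T g) (h₀ : f 0 = g 0) :
    EqOn f g (Icc 0 T) :=
  ODE_solution_unique_of_mem_Icc_right (v := fun t => v (s t)) (s := fun _ => univ) (K := K)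
    (fun t _ => (hK (s t)).lipschitzOnWith) hf.1 hf.2 (fun _ _ => mem_univ _) hg.1 hg.2
    (fun _ _ => mem_univ _) h₀

theorem exists_solution_of_bounded_lipschitz [CompleteSpace E] {w : E → E}
    (hK : LipschitzWith K w) {L : NNReal} (hL : ∀ x, ‖w x‖ ≤ L) {a b : ℝ} (hab : a ≤ b) (x₀ : E) :
    ∃ f : ℝ → E, f a = x₀ ∧ ∀ t ∈ Icc a b, HasDerivWithinAt f (w (f t)) (Icc a b) t := by
  -- A field bounded by `L` moves a point by at most `L (b - a)`; a ball of this radius makes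
  -- Picard–Lindelöf work on the whole interval at once.
  have hp : IsPicardLindelof (fun _ => w) (tmin := a) (tmax := b) ⟨a, left_mem_Icc.2 hab⟩ x₀
      (L * (b - a).toNNReal) 0 L K := by
    refine IsPicardLindelof.of_time_independent (fun x _ => hL x) hK.lipschitzOnWith ?_
    simp [hab]
  exact hp.exists_eq_forall_mem_Icc_hasDerivWithinAt₀

/-- A solution can be continued through a time interval in which the mode is constant. -/
theorem IsSwitchedSolution.extend [CompleteSpace E] (hK : ∀ k, LipschitzWith K (v k)) {L : NNReal}
    (hL : ∀ k x, ‖v k x‖ ≤ L) {T₁ T₂ : ℝ} (h₀ : 0 ≤ T₁) (h : T₁ ≤ T₂) {f : ℝ → E}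
    (hf : IsSwitchedSolution v s T₁ f) {k : ι} (hk : ∀ t ∈ Ico T₁ T₂, s t = k) :
    ∃ g, g 0 = f 0 ∧ IsSwitchedSolution v s T₂ g := by
  obtain ⟨u, hu₀, hu⟩ := exists_solution_of_bounded_lipschitz (hK k) (hL k) h (f T₁)
  refine ⟨fun t => if t ≤ T₁ then f t else u t, by simp [h₀], ?_, ?_⟩
  · have hIcc : Icc 0 T₂ = Icc 0 T₁ ∪ Icc T₁ T₂ := (Icc_union_Icc_eq_Icc h₀ h).symm
    have hleft : ContinuousOn (fun t => if t ≤ T₁ then f t else u t) (Icc 0 T₁) :=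
      hf.1.congr fun t ht => by simp [ht.2]
    have hright : ContinuousOn (fun t => if t ≤ T₁ then f t else u t) (Icc T₁ T₂) :=
      ContinuousOn.congr (fun t ht => (hu t ht).continuousWithinAt) fun t ht => by
        rcases ht.1.eq_or_lt with rfl | hlt
        · simp [hu₀]
        · simp [not_le.2 hlt]
    rw [hIcc]
    exact hleft.union_of_isClosed hright isClosed_Icc isClosed_Icc
  · intro t ht
    rcases lt_or_ge t T₁ with hlt | hge
    · have hd := hf.2 t ⟨ht.1, hlt⟩
      simp only [if_pos hlt.le]
      refine hd.congr_of_eventuallyEq ?_ (by simp [hlt.le])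
      filter_upwards [mem_nhdsWithin_of_mem_nhds (Iio_mem_nhds hlt)] with τ hτ
      simp [(mem_Iio.1 hτ).le]
    · have hval : ∀ τ, T₁ ≤ τ → (if τ ≤ T₁ then f τ else u τ) = u τ := fun τ hτ => by
        rcases hτ.eq_or_lt with rfl | hlt
        · simp [hu₀]
        · simp [not_le.2 hlt]
      have hmem : Icc T₁ T₂ ∈ 𝓝[≥] t :=
        mem_of_superset (Icc_mem_nhdsGE ht.2) (Icc_subset_Icc_left hge)
      have hd := (hu t ⟨hge, ht.2.le⟩).mono_of_mem_nhdsWithin hmem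
      rw [hk t ⟨hge, ht.2⟩]
      simp only [hval t hge]
      refine hd.congr (fun τ hτ => hval τ (hge.trans hτ)) (hval t hge)

/-- At the infimum `S` of the times that cannot be reached, constancy of the mode to the left gives
a solution up to `S`, and constancy to the right continues it past `S`. -/
theorem exists_isSwitchedSolution [CompleteSpace E] (hK : ∀ k, LipschitzWith K (v k))
    {L : NNReal} (hL : ∀ k x, ‖v k x‖ ≤ L)
    (hs : (∀ t, 0 ≤ t → ∀ᶠ τ in 𝓝[>] t, s τ = s t) ∧
      ∀ t, 0 < t → ∃ k, ∀ᶠ τ in 𝓝[<] t, s τ = k) (x₀ : E) {T : ℝ} (hT : 0 ≤ T) :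
    ∃ f, f 0 = x₀ ∧ IsSwitchedSolution v s T f := by
  by_contra hbad
  set B : Set ℝ := {t | 0 ≤ t ∧ ¬ ∃ f, f 0 = x₀ ∧ IsSwitchedSolution v s t f} with hB
  have hbdd : BddBelow B := ⟨0, fun t ht => ht.1⟩
  have hne : B.Nonempty := ⟨T, hT, hbad⟩
  set S := sInf B with hS
  have hS₀ : 0 ≤ S := le_csInf hne fun t ht => ht.1
  have hlt : ∀ t, 0 ≤ t → t < S → ∃ f, f 0 = x₀ ∧ IsSwitchedSolution v s t f := fun t h₀ ht => by
    by_contra hc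
    exact not_lt.2 (csInf_le hbdd (show t ∈ B from ⟨h₀, hc⟩)) ht
  have hsol : ∃ f, f 0 = x₀ ∧ IsSwitchedSolution v s S f := by
    rcases hS₀.eq_or_lt with h0 | hpos
    · refine ⟨fun _ => x₀, rfl, continuousOn_const, fun t ht => ?_⟩
      rw [← h0] at ht
      exact absurd (ht.1.trans_lt ht.2) (lt_irrefl _)
    · obtain ⟨k, hk⟩ := hs.2 S hpos
      obtain ⟨l, hl, hl'⟩ := (mem_nhdsLT_iff_exists_Ico_subset).1 hk
      have hm : max l 0 < S := max_lt hl hpos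
      obtain ⟨f, hf₀, hf⟩ := hlt (max l 0) (le_max_right _ _) hm
      obtain ⟨g, hg₀, hg⟩ := hf.extend hK hL (le_max_right _ _) hm.le (k := k)
        (fun t ht => hl' ⟨(le_max_left _ _).trans ht.1, ht.2⟩)
      exact ⟨g, hg₀.trans hf₀, hg⟩
  obtain ⟨f, hf₀, hf⟩ := hsol
  obtain ⟨u, hu, hu'⟩ := mem_nhdsGT_iff_exists_Ioo_subset.1 (hs.1 S hS₀)
  obtain ⟨t, ht, htu⟩ := exists_lt_of_csInf_lt hne hu
  have hSt : S ≤ t := csInf_le hbdd ht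
  obtain ⟨g, hg₀, hg⟩ := hf.extend hK hL hS₀ hSt (k := s S) (fun τ hτ => by
    rcases hτ.1.eq_or_lt with rfl | hlt'
    · rfl
    · exact hu' ⟨hlt', hτ.2.trans htu⟩)
  exact ht.2 ⟨g, hg₀.trans hf₀, hg⟩

theorem exists_global_switched_solution [CompleteSpace E] (hK : ∀ k, LipschitzWith K (v k))
    {L : NNReal} (hL : ∀ k x, ‖v k x‖ ≤ L)
    (hs : (∀ t, 0 ≤ t → ∀ᶠ τ in 𝓝[>] t, s τ = s t) ∧
      ∀ t, 0 < t → ∃ k, ∀ᶠ τ in 𝓝[<] t, s τ = k) (x₀ : E) :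
    ∃ f : ℝ → E, f 0 = x₀ ∧ ContinuousOn f (Ici 0) ∧
      ∀ t, 0 ≤ t → HasDerivWithinAt f (v (s t) (f t)) (Ici t) t := by
  choose g hg₀ hg using fun n : ℕ =>
    exists_isSwitchedSolution (K := K) hK hL hs x₀ (Nat.cast_nonneg (α := ℝ) n)
  have hagree : ∀ n m : ℕ, n ≤ m → EqOn (g n) (g m) (Icc 0 n) := fun n m hnm =>
    (hg n).eqOn hK ((hg m).mono (Nat.cast_le.2 hnm)) ((hg₀ n).trans (hg₀ m).symm)
  -- By uniqueness the solutions on `[0, n]` are restrictions of one another, so they glue.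
  have hF : ∀ n : ℕ, EqOn (fun t => g ⌈t⌉₊ t) (g n) (Icc 0 n) := fun n t ht =>
    hagree _ _ (Nat.ceil_le.2 ht.2) ⟨ht.1, Nat.le_ceil t⟩
  have hlt : ∀ t : ℝ, t < (⌈t⌉₊ + 1 : ℕ) := fun t => by
    push_cast
    linarith [Nat.le_ceil t]
  refine ⟨fun t => g ⌈t⌉₊ t, by simp [hg₀], fun t ht => ?_, fun t ht => ?_⟩
  -- The extra `+ 1` puts `t` strictly before the right endpoint, even when `t` is an integer.
  · have h₁ := ((hg (⌈t⌉₊ + 1)).1.congr (hF _)) t ⟨ht, (hlt t).le⟩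
    refine h₁.mono_of_mem_nhdsWithin ?_
    rw [← Ici_inter_Iic]
    exact inter_mem self_mem_nhdsWithin (mem_nhdsWithin_of_mem_nhds (Iic_mem_nhds (hlt t)))
  · have h₁ := (hg (⌈t⌉₊ + 1)).2 t ⟨ht, hlt t⟩
    have hval := hF (⌈t⌉₊ + 1) ⟨ht, (hlt t).le⟩
    change HasDerivWithinAt _ (v (s t) (g ⌈t⌉₊ t)) _ _
    rw [show g ⌈t⌉₊ t = g (⌈t⌉₊ + 1) t from hval]
    refine h₁.congr_of_eventuallyEq ?_ hval
    filter_upwards [Icc_mem_nhdsGE (hlt t)] with τ hτ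
    exact hF (⌈t⌉₊ + 1) ⟨ht.trans hτ.1, hτ.2⟩

end SwitchedODE

/-! ### Sums over the links of a graph -/

section Links

open Classical in
/-- The sum of a function over the links of a graph, each taken in both directions. -/
noncomputable def linkSum (H : SimpleGraph (Fin N)) (f : Fin N → Fin N → ℝ) : ℝ :=
  ∑ i, ∑ j, if H.Adj i j then f i j else 0

theorem linkSum_le_linkSum {H : SimpleGraph (Fin N)} {f g : Fin N → Fin N → ℝ}
    (h : ∀ i j, H.Adj i j → f i j ≤ g i j) : linkSum H f ≤ linkSum H g :=
  Finset.sum_le_sum fun i _ => Finset.sum_le_sum fun j _ => by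
    split_ifs with hij
    · exact h i j hij
    · exact le_rfl

theorem linkSum_nonneg {H : SimpleGraph (Fin N)} {f : Fin N → Fin N → ℝ}
    (h : ∀ i j, H.Adj i j → 0 ≤ f i j) : 0 ≤ linkSum H f :=
  Finset.sum_nonneg fun i _ => Finset.sum_nonneg fun j _ => by
    split_ifs with hij
    · exact h i j hij
    · exact le_rfl

theorem linkSum_const_mul (H : SimpleGraph (Fin N)) (a : ℝ) (f : Fin N → Fin N → ℝ) :
    linkSum H (fun i j => a * f i j) = a * linkSum H f := by
  simp only [linkSum, Finset.mul_sum, mul_ite, mul_zero]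

theorem linkSum_swap (H : SimpleGraph (Fin N)) (f : Fin N → Fin N → ℝ) :
    linkSum H (fun i j => f j i) = linkSum H f := by
  unfold linkSum
  rw [Finset.sum_comm]
  refine Finset.sum_congr rfl fun i _ => Finset.sum_congr rfl fun j _ => ?_
  rw [H.adj_comm]

theorem le_linkSum {H : SimpleGraph (Fin N)} {f : Fin N → Fin N → ℝ}
    (h : ∀ i j, H.Adj i j → 0 ≤ f i j) {u v : Fin N} (huv : H.Adj u v) : f u v ≤ linkSum H f := by
  classical
  have h₀ : ∀ i j, 0 ≤ if H.Adj i j then f i j else 0 := fun i j => by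
    split_ifs with hij
    · exact h i j hij
    · exact le_rfl
  have h₁ := Finset.single_le_sum (f := fun i => ∑ j, if H.Adj i j then f i j else 0)
    (s := Finset.univ) (fun i _ => Finset.sum_nonneg fun j _ => h₀ i j) (Finset.mem_univ u)
  have h₂ := Finset.single_le_sum (f := fun j => if H.Adj u j then f u j else 0)
    (s := Finset.univ) (fun j _ => h₀ u j) (Finset.mem_univ v)
  simp only [if_pos huv] at h₂
  exact h₂.trans (by unfold linkSum; convert h₁)

theorem laplacianForm_eq (H : SimpleGraph (Fin N)) (e : Fin N → ℝ) :
    laplacianForm H e = linkSum H (fun i j => (e i - e j) ^ 2) / 2 := by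
  unfold laplacianForm linkSum
  rw [← SimpleGraph.lapMatrix_toLinearMap₂', Matrix.toLinearMap₂'_apply']

open Classical in
/-- Symmetric coupling conserves the total. -/
theorem sum_coupling_eq_zero (H : SimpleGraph (Fin N)) {A : Fin N → Fin N → ℝ} (w : Fin N → ℝ)
    (hA : ∀ i j, A i j = A j i) :
    ∑ i, (∑ j, if H.Adj i j then A i j * (w j - w i) else 0) = 0 := by
  have h := linkSum_swap H fun i j => A i j * (w j - w i)
  have h' : linkSum H (fun i j => A j i * (w i - w j)) =
      - linkSum H fun i j => A i j * (w j - w i) := by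
    rw [← neg_one_mul, ← linkSum_const_mul]
    congr 1
    funext i j
    rw [hA j i]
    ring
  have : linkSum H (fun i j => A i j * (w j - w i)) = 0 := by linarith
  exact this

open Classical in
-- Discrete integration by parts: averaging the sum with its image under swapping `i` and `j` gives
-- the squares and the factor `1 / 2`.
theorem sum_mul_coupling (H : SimpleGraph (Fin N)) {A : Fin N → Fin N → ℝ} (w : Fin N → ℝ)
    (hA : ∀ i j, A i j = A j i) :
    ∑ i, w i * (∑ j, if H.Adj i j then A i j * (w j - w i) else 0) =
      -(1 / 2) * linkSum H (fun i j => A i j * (w i - w j) ^ 2) := by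
  have h₀ : ∑ i, w i * (∑ j, if H.Adj i j then A i j * (w j - w i) else 0) =
      linkSum H fun i j => w i * (A i j * (w j - w i)) := by
    simp only [linkSum, Finset.mul_sum, mul_ite, mul_zero]
  have h₁ := linkSum_swap H fun i j => w i * (A i j * (w j - w i))
  have h₂ : linkSum H (fun i j => w i * (A i j * (w j - w i))) +
      linkSum H (fun i j => w j * (A j i * (w i - w j))) =
      - linkSum H (fun i j => A i j * (w i - w j) ^ 2) := by
    rw [← neg_one_mul, ← linkSum_const_mul]
    simp only [linkSum, ← Finset.sum_add_distrib, ite_add_ite, add_zero]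
    refine Finset.sum_congr rfl fun i _ => Finset.sum_congr rfl fun j _ => ?_
    rw [hA j i]
    congr 1
    ring
  rw [h₀]
  linarith

theorem exists_sq_sub_le_of_reachable (H : SimpleGraph (Fin N)) {u v : Fin N}
    (h : H.Reachable u v) :
    ∃ C : ℝ, 0 ≤ C ∧ ∀ e : Fin N → ℝ,
      (e u - e v) ^ 2 ≤ C * linkSum H (fun i j => (e i - e j) ^ 2) := by
  obtain ⟨p⟩ := h
  induction p with
  | nil => exact ⟨0, le_rfl, fun e => by simp⟩
  | @cons u v w huv p ih =>
    obtain ⟨C, hC, ih⟩ := ih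
    -- From `(x + y)^2 ≤ 2 x^2 + 2 y^2`, splitting off the first edge of the walk.
    refine ⟨2 + 2 * C, by positivity, fun e => ?_⟩
    have h₁ := le_linkSum (f := fun i j => (e i - e j) ^ 2) (fun i j _ => sq_nonneg _) huv
    have h₂ := ih e
    nlinarith [sq_nonneg (e u - e v - (e v - e w))]

/-- The Poincaré inequality, uniformly for finitely many connected graphs. -/
theorem exists_poincare (G : Fin M → SimpleGraph (Fin N)) (hG : ∀ k, (G k).Connected) :
    ∃ C : ℝ, 0 < C ∧ ∀ k, ∀ e : Fin N → ℝ, ∑ i, e i = 0 →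
      ∑ i, e i ^ 2 ≤ C * linkSum (G k) (fun i j => (e i - e j) ^ 2) := by
  choose C hC hle using fun k u v => exists_sq_sub_le_of_reachable (G k) ((hG k).preconnected u v)
  have hpos : ∀ k, 0 ≤ ∑ i, ∑ j, C k i j := fun k =>
    Finset.sum_nonneg fun i _ => Finset.sum_nonneg fun j _ => hC k i j
  -- Summing over `k` makes the constant uniform, and the `1` makes it positive even if all summands
  -- vanish.
  refine ⟨1 + ∑ k, ∑ i, ∑ j, C k i j,
    add_pos_of_pos_of_nonneg one_pos (Finset.sum_nonneg fun k _ => hpos k), fun k e he => ?_⟩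
  set S := linkSum (G k) (fun i j => (e i - e j) ^ 2) with hS
  have hS₀ : 0 ≤ S := linkSum_nonneg fun i j _ => sq_nonneg _
  have hN : (1 : ℝ) ≤ N := by
    obtain ⟨i⟩ := (hG k).nonempty
    exact_mod_cast (Nat.zero_le _).trans_lt i.2
  -- For a vector of sum zero the cross terms vanish, so the variance is expressed by pairwise
  -- differences.
  have hsum : ∑ i, ∑ j, (e i - e j) ^ 2 = 2 * N * ∑ i, e i ^ 2 := by
    have : ∀ i j, (e i - e j) ^ 2 = e i ^ 2 + e j ^ 2 - 2 * e i * e j := fun i j => by ring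
    simp only [this, Finset.sum_sub_distrib, Finset.sum_add_distrib, ← Finset.mul_sum, he,
      Finset.sum_const, Finset.card_univ, Fintype.card_fin, nsmul_eq_mul, mul_zero]
    ring
  have hsq : 0 ≤ ∑ i, e i ^ 2 := Finset.sum_nonneg fun i _ => sq_nonneg _
  calc ∑ i, e i ^ 2 ≤ 2 * N * ∑ i, e i ^ 2 := le_mul_of_one_le_left hsq (by linarith)
    _ = ∑ i, ∑ j, (e i - e j) ^ 2 := hsum.symm
    _ ≤ ∑ i, ∑ j, C k i j * S :=
        Finset.sum_le_sum fun i _ => Finset.sum_le_sum fun j _ => hle k i j e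
    _ = (∑ i, ∑ j, C k i j) * S := by simp only [Finset.sum_mul]
    _ ≤ _ := by
        gcongr
        have := Finset.single_le_sum (f := fun k => ∑ i, ∑ j, C k i j) (s := Finset.univ)
          (fun k _ => hpos k) (Finset.mem_univ k)
        linarith

end Links

/-! ### The protocol on a time interval -/

open Classical in
/-- `(P, A)` follows the protocol on `[0, T)` and stays within the capacity limits there. -/
structure IsProtocolSolutionOn (gen : Fin N → Generator) (δ : ℝ) (β : Fin N → Fin N → ℝ)
    (G : Fin M → SimpleGraph (Fin N)) (s : ℝ → Fin M) (T : ℝ)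
    (P : ℝ → Fin N → ℝ) (A : ℝ → Fin N → Fin N → ℝ) : Prop where
  continuousOn_power : ∀ i, ContinuousOn (fun t => P t i) (Ico 0 T)
  continuousOn_weight : ∀ i j, ContinuousOn (fun t => A t i j) (Ico 0 T)
  power_deriv : ∀ t ∈ Ico 0 T, ∀ i, HasDerivWithinAt (fun τ => P τ i)
    (∑ j, if (G (s t)).Adj i j then
      A t i j * (incCost gen δ (P t) j - incCost gen δ (P t) i) else 0) (Ici t) t
  weight_deriv : ∀ t ∈ Ico 0 T, ∀ i j, HasDerivWithinAt (fun τ => A τ i j)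
    (if (G (s t)).Adj i j then
      β i j * (incCost gen δ (P t) i - incCost gen δ (P t) j) ^ 2 else 0) (Ici t) t
  withinLimits : ∀ t ∈ Ico 0 T, WithinLimits gen (P t)

namespace IsProtocolSolutionOn

variable {gen : Fin N → Generator} {δ D : ℝ} {β : Fin N → Fin N → ℝ}
  {G : Fin M → SimpleGraph (Fin N)} {s : ℝ → Fin M} {T : ℝ}
  {P : ℝ → Fin N → ℝ} {A : ℝ → Fin N → Fin N → ℝ}

theorem weight_symm (h : IsProtocolSolutionOn gen δ β G s T P A)
    (hβ : ∀ i j, β i j = β j i) (hA : ∀ i j, A 0 i j = A 0 j i) {t : ℝ} (ht : t ∈ Ico 0 T)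
    (i j : Fin N) : A t i j = A t j i := by
  have hsub : Icc 0 t ⊆ Ico 0 T := fun x hx => ⟨hx.1, hx.2.trans_lt ht.2⟩
  have hc : ContinuousOn (fun τ => A τ i j - A τ j i) (Icc 0 t) :=
    ((h.continuousOn_weight i j).sub (h.continuousOn_weight j i)).mono hsub
  have hd : ∀ x ∈ Ico 0 t, HasDerivWithinAt (fun τ => A τ i j - A τ j i) 0 (Ici x) x := by
    intro x hx
    have hx' := hsub (Ico_subset_Icc_self hx)
    refine ((h.weight_deriv x hx' i j).sub (h.weight_deriv x hx' j i)).congr_deriv ?_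
    rw [hβ j i]
    by_cases hij : (G (s x)).Adj i j
    · rw [if_pos hij, if_pos hij.symm]
      ring
    · rw [if_neg hij, if_neg fun hji => hij hji.symm, sub_zero]
  have := constant_of_has_deriv_right_zero hc hd t (right_mem_Icc.2 ht.1)
  linarith [hA i j]

theorem weight_mono (h : IsProtocolSolutionOn gen δ β G s T P A)
    (hβ : ∀ i j, 0 < β i j) {a b : ℝ} (ha : 0 ≤ a) (hab : a ≤ b) (hb : b < T)
    (i j : Fin N) : A a i j ≤ A b i j := by
  have hsub : Icc a b ⊆ Ico 0 T := fun x hx => ⟨ha.trans hx.1, hx.2.trans_lt hb⟩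
  have := le_of_right_deriv_nonpos hab ((h.continuousOn_weight i j).mono hsub).neg
    (fun x hx => (h.weight_deriv x (hsub (Ico_subset_Icc_self hx)) i j).neg) (fun x _ => by
      split_ifs
      · have := mul_nonneg (hβ i j).le
          (sq_nonneg (incCost gen δ (P x) i - incCost gen δ (P x) j))
        linarith
      · simp)
  simpa using this

theorem weight_eq (h : IsProtocolSolutionOn gen δ β G s T P A) {t : ℝ} (ht : t ∈ Ico 0 T)
    {i j : Fin N} (hij : ∀ k, ¬ (G k).Adj i j) : A t i j = A 0 i j := by
  have hsub : Icc 0 t ⊆ Ico 0 T := fun x hx => ⟨hx.1, hx.2.trans_lt ht.2⟩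
  refine constant_of_has_deriv_right_zero ((h.continuousOn_weight i j).mono hsub)
    (fun x hx => ?_) t (right_mem_Icc.2 ht.1)
  simpa [hij] using h.weight_deriv x (hsub (Ico_subset_Icc_self hx)) i j

theorem sum_power (h : IsProtocolSolutionOn gen δ β G s T P A)
    (hβ : ∀ i j, β i j = β j i) (hA : ∀ i j, A 0 i j = A 0 j i) {t : ℝ} (ht : t ∈ Ico 0 T) :
    ∑ i, P t i = ∑ i, P 0 i := by
  have hsub : Icc 0 t ⊆ Ico 0 T := fun x hx => ⟨hx.1, hx.2.trans_lt ht.2⟩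
  refine constant_of_has_deriv_right_zero (f := fun τ => ∑ i, P τ i)
    (continuousOn_finsetSum _ fun i _ => (h.continuousOn_power i).mono hsub)
    (fun x hx => ?_) t (right_mem_Icc.2 ht.1)
  have hx' := hsub (Ico_subset_Icc_self hx)
  exact (HasDerivWithinAt.fun_sum fun i _ => h.power_deriv x hx' i).congr_deriv
    (sum_coupling_eq_zero _ _ (h.weight_symm hβ hA hx'))

theorem totalCost_deriv (h : IsProtocolSolutionOn gen δ β G s T P A)
    (hβ : ∀ i j, β i j = β j i) (hA : ∀ i j, A 0 i j = A 0 j i) {t : ℝ} (ht : t ∈ Ico 0 T) :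
    HasDerivWithinAt (fun τ => totalCost gen δ (P τ))
      (-(1 / 2) * linkSum (G (s t))
        (fun i j => A t i j * (incCost gen δ (P t) i - incCost gen δ (P t) j) ^ 2)) (Ici t) t := by
  rw [← sum_mul_coupling _ _ (h.weight_symm hβ hA ht)]
  refine HasDerivWithinAt.fun_sum fun i _ => ?_
  have hl := h.withinLimits t ht i
  exact ((gen i).hasDerivAt_barrierCost δ hl.1 hl.2).comp_hasDerivWithinAt t (h.power_deriv t ht i)

theorem continuousOn_totalCost (h : IsProtocolSolutionOn gen δ β G s T P A) :
    ContinuousOn (fun τ => totalCost gen δ (P τ)) (Ico 0 T) :=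
  continuousOn_finsetSum _ fun i _ t ht =>
    ((gen i).continuousAt_barrierCost δ (h.withinLimits t ht i)).comp_continuousWithinAt
      (f := fun t => P t i) (h.continuousOn_power i t ht)

/-- Weights on links start positive and only grow, so the dissipation has a sign. -/
theorem totalCost_le (h : IsProtocolSolutionOn gen δ β G s T P A)
    (hβ : ∀ i j, 0 < β i j) (hβs : ∀ i j, β i j = β j i) (hA : AdmissibleWeights G (A 0))
    {t : ℝ} (ht : t ∈ Ico 0 T) : totalCost gen δ (P t) ≤ totalCost gen δ (P 0) := by
  have hsub : Icc 0 t ⊆ Ico 0 T := fun x hx => ⟨hx.1, hx.2.trans_lt ht.2⟩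
  refine le_of_right_deriv_nonpos (f := fun τ => totalCost gen δ (P τ)) ht.1
    (h.continuousOn_totalCost.mono hsub)
    (fun x hx => h.totalCost_deriv hβs hA.1 (hsub (Ico_subset_Icc_self hx))) (fun x hx => ?_)
  have hx' := hsub (Ico_subset_Icc_self hx)
  have := linkSum_nonneg (H := G (s x)) (f := fun i j =>
    A x i j * (incCost gen δ (P x) i - incCost gen δ (P x) j) ^ 2) fun i j hij =>
      mul_nonneg ((hA.2 _ i j hij).le.trans (h.weight_mono hβ le_rfl hx'.1 hx'.2 i j)) (sq_nonneg _)
  linarith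

/-- The factor `1 / (4 β)` cancels the `β` of the weight dynamics: the penalty contributes `-(γ / 2)
(θ - a) (w_i - w_j)^2` per link and the cost `-(γ / 2) a (w_i - w_j)^2`, so `a` drops out. Links
that are down have constant weight and contribute nothing, whence the sum over the current graph
only. -/
theorem energy_deriv (h : IsProtocolSolutionOn gen δ β G s T P A)
    (hβ : ∀ i j, 0 < β i j) (hβs : ∀ i j, β i j = β j i) (hA : ∀ i j, A 0 i j = A 0 j i)
    (γ : ℝ) (θ : Fin N → Fin N → ℝ) (Q : Fin N → ℝ) {t : ℝ} (ht : t ∈ Ico 0 T) :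
    HasDerivWithinAt (fun τ => energy gen δ β G γ θ Q (P τ) (A τ))
      (-(γ / 2) * linkSum (G (s t))
        (fun i j => θ i j * (incCost gen δ (P t) i - incCost gen δ (P t) j) ^ 2)) (Ici t) t := by
  classical
  have h₁ := (((h.totalCost_deriv hβs hA ht).sub_const (totalCost gen δ Q)).const_mul γ)
  have h₂ : HasDerivWithinAt (fun τ => ∑ i, ∑ j, if ∃ k, (G k).Adj i j then
      γ / (4 * β i j) * (θ i j - A τ i j) ^ 2 else 0)
      (linkSum (G (s t)) fun i j => -(γ / 2) * ((θ i j - A t i j) *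
        (incCost gen δ (P t) i - incCost gen δ (P t) j) ^ 2)) (Ici t) t := by
    refine HasDerivWithinAt.fun_sum fun i _ => HasDerivWithinAt.fun_sum fun j _ => ?_
    by_cases hex : ∃ k, (G k).Adj i j
    · simp only [if_pos hex]
      have hd := (((h.weight_deriv t ht i j).const_sub (θ i j)).pow 2).const_mul
        (γ / (4 * β i j))
      refine hd.congr_deriv ?_
      have hne := (hβ i j).ne'
      by_cases hadj : (G (s t)).Adj i j
      · simp only [if_pos hadj]
        field_simp
        push_cast
        ring
      · simp [if_neg hadj]
    · have hadj : ¬ (G (s t)).Adj i j := fun hh => hex ⟨_, hh⟩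
      simp only [if_neg hex, if_neg hadj]
      exact hasDerivWithinAt_const _ _ _
  have h₃ := h₁.add h₂
  refine (h₃.congr_deriv ?_).congr (fun τ _ => ?_) ?_
  · rw [linkSum_const_mul]
    have : linkSum (G (s t)) (fun i j => θ i j * (incCost gen δ (P t) i - incCost gen δ (P t) j) ^ 2)
        = linkSum (G (s t)) (fun i j => A t i j * (incCost gen δ (P t) i - incCost gen δ (P t) j) ^ 2)
        + linkSum (G (s t)) (fun i j => (θ i j - A t i j) *
          (incCost gen δ (P t) i - incCost gen δ (P t) j) ^ 2) := by
      simp only [linkSum, ← Finset.sum_add_distrib, ite_add_ite, add_zero]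
      refine Finset.sum_congr rfl fun i _ => Finset.sum_congr rfl fun j _ => ?_
      congr 1
      ring
    rw [this]
    ring
  · simp only [energy, totalCost, Finset.sum_sub_distrib, Pi.add_apply]
  · simp only [energy, totalCost, Finset.sum_sub_distrib, Pi.add_apply]

theorem energy_le (h : IsProtocolSolutionOn gen δ β G s T P A)
    (hβ : ∀ i j, 0 < β i j) (hβs : ∀ i j, β i j = β j i) (hA : ∀ i j, A 0 i j = A 0 j i)
    {γ : ℝ} (hγ : 0 ≤ γ) {θ : Fin N → Fin N → ℝ} (hθ : ∀ k i j, (G k).Adj i j → 0 ≤ θ i j)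
    (Q : Fin N → ℝ) {t : ℝ} (ht : t ∈ Ico 0 T) :
    energy gen δ β G γ θ Q (P t) (A t) ≤ energy gen δ β G γ θ Q (P 0) (A 0) := by
  have hsub : Icc 0 t ⊆ Ico 0 T := fun x hx => ⟨hx.1, hx.2.trans_lt ht.2⟩
  refine le_of_right_deriv_nonpos (f := fun τ => energy gen δ β G γ θ Q (P τ) (A τ)) ht.1 ?_
    (fun x hx => h.energy_deriv hβ hβs hA γ θ Q (hsub (Ico_subset_Icc_self hx))) (fun x hx => ?_)
  · refine ContinuousOn.add ?_ ?_
    · simp only [Finset.sum_sub_distrib]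
      exact ((h.continuousOn_totalCost.mono hsub).sub continuousOn_const).const_mul γ
    · refine continuousOn_finsetSum _ fun i _ => continuousOn_finsetSum _ fun j _ => ?_
      split_ifs
      · exact ((continuousOn_const.sub ((h.continuousOn_weight i j).mono hsub)).pow 2).const_mul _
      · exact continuousOn_const
  · have := linkSum_nonneg (H := G (s x)) (f := fun i j =>
      θ i j * (incCost gen δ (P x) i - incCost gen δ (P x) j) ^ 2) fun i j hij =>
        mul_nonneg (hθ _ i j hij) (sq_nonneg _)
    nlinarith

end IsProtocolSolutionOn

/-! ### Positivity of the energy and bounds for the weights -/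

section Energy

variable {gen : Fin N → Generator} {δ D : ℝ} {β : Fin N → Fin N → ℝ}
  {G : Fin M → SimpleGraph (Fin N)} {Q : Fin N → ℝ}

/-- The energy controls the excess cost and the deviation of each weight. -/
theorem energy_lower_bounds (hβ : ∀ i j, 0 < β i j) (hc : ∀ i, 0 < (gen i).c) (hδ : 0 < δ)
    (hQ : IsOptimalDispatch gen δ D Q) {γ : ℝ} (hγ : 0 ≤ γ) (θ : Fin N → Fin N → ℝ)
    {P : Fin N → ℝ} (hP : P ∈ dispatchSet gen D) (A : Fin N → Fin N → ℝ) :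
    0 ≤ energy gen δ β G γ θ Q P A ∧
    γ * ∑ i, ((gen i).barrierCost δ (P i) - (gen i).barrierCost δ (Q i)) ≤
      energy gen δ β G γ θ Q P A ∧
    ∀ k i j, (G k).Adj i j →
      γ / (4 * β i j) * (θ i j - A i j) ^ 2 ≤ energy gen δ β G γ θ Q P A := by
  classical
  have h₁ : 0 ≤ γ * ∑ i, ((gen i).barrierCost δ (P i) - (gen i).barrierCost δ (Q i)) :=
    mul_nonneg hγ ((Finset.sum_nonneg fun i _ => mul_nonneg (hc i).le (sq_nonneg _)).trans
      (hQ.quadratic_growth hδ hP))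
  have h₂ : ∀ i j, 0 ≤ if ∃ k, (G k).Adj i j then γ / (4 * β i j) * (θ i j - A i j) ^ 2 else 0 :=
    fun i j => by
      have := hβ i j
      split_ifs <;> positivity
  have h₃ : 0 ≤ ∑ i, ∑ j, if ∃ k, (G k).Adj i j then
      γ / (4 * β i j) * (θ i j - A i j) ^ 2 else 0 :=
    Finset.sum_nonneg fun i _ => Finset.sum_nonneg fun j _ => h₂ i j
  have h₄ : ∀ k i j, (G k).Adj i j → γ / (4 * β i j) * (θ i j - A i j) ^ 2 ≤
      ∑ i, ∑ j, if ∃ k, (G k).Adj i j then γ / (4 * β i j) * (θ i j - A i j) ^ 2 else 0 := by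
    intro k i j hij
    have a₁ := Finset.single_le_sum (s := Finset.univ) (f := fun i => ∑ j,
      if ∃ k, (G k).Adj i j then γ / (4 * β i j) * (θ i j - A i j) ^ 2 else 0)
      (fun i _ => Finset.sum_nonneg fun j _ => h₂ i j) (Finset.mem_univ i)
    have a₂ := Finset.single_le_sum (s := Finset.univ) (f := fun j =>
      if ∃ k, (G k).Adj i j then γ / (4 * β i j) * (θ i j - A i j) ^ 2 else 0)
      (fun j _ => h₂ i j) (Finset.mem_univ j)
    simp only [if_pos (⟨k, hij⟩ : ∃ k, (G k).Adj i j)] at a₂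
    exact a₂.trans a₁
  have e : energy gen δ β G γ θ Q P A =
      γ * ∑ i, ((gen i).barrierCost δ (P i) - (gen i).barrierCost δ (Q i)) +
      ∑ i, ∑ j, if ∃ k, (G k).Adj i j then γ / (4 * β i j) * (θ i j - A i j) ^ 2 else 0 := by
    unfold energy
    congr!
  rw [e]
  exact ⟨by linarith, by linarith, fun k i j hij => by linarith [h₄ k i j hij]⟩

theorem energy_eq_zero_iff (hβ : ∀ i j, 0 < β i j) (hc : ∀ i, 0 < (gen i).c) (hδ : 0 < δ)
    (hQ : IsOptimalDispatch gen δ D Q) {γ : ℝ} (hγ : 0 < γ) (θ : Fin N → Fin N → ℝ)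
    {P : Fin N → ℝ} (hP : P ∈ dispatchSet gen D) (A : Fin N → Fin N → ℝ) :
    energy gen δ β G γ θ Q P A = 0 ↔ P = Q ∧ ∀ k i j, (G k).Adj i j → A i j = θ i j := by
  constructor
  · intro h
    obtain ⟨-, h₁, h₂⟩ := energy_lower_bounds (G := G) hβ hc hδ hQ hγ.le θ hP A
    rw [h] at h₁ h₂
    refine ⟨hQ.eq_of_excess_le_zero hc hδ hP (nonpos_of_mul_nonpos_right h₁ hγ),
      fun k i j hij => ?_⟩
    have hpos : 0 < γ / (4 * β i j) := by
      have := hβ i j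
      positivity
    have h₃ := nonpos_of_mul_nonpos_right (h₂ k i j hij) hpos
    have h₄ := pow_eq_zero_iff two_ne_zero |>.1 (le_antisymm h₃ (sq_nonneg _))
    linarith
  · rintro ⟨rfl, h⟩
    unfold energy
    simp only [sub_self, Finset.sum_const_zero, mul_zero, zero_add]
    refine Finset.sum_eq_zero fun i _ => Finset.sum_eq_zero fun j _ => ?_
    split_ifs with hij
    · obtain ⟨k, hk⟩ := hij
      rw [h k i j hk]
      simp
    · rfl

/-- A bound for the weights in terms of the initial data. -/
noncomputable def weightBound (gen : Fin N → Generator) (δ : ℝ) (β : Fin N → Fin N → ℝ)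
    (G : Fin M → SimpleGraph (Fin N)) (Q P₀ : Fin N → ℝ) (A₀ : Fin N → Fin N → ℝ) : ℝ :=
  ∑ i, ∑ j, (|A₀ i j| + √(4 * β i j * energy gen δ β G 1 A₀ Q P₀ A₀))

/-- Take the energy with the initial weights as targets. Since it does not increase, it bounds the
squared deviation of every link weight; weights of pairs that are never linked are constant. -/
theorem IsProtocolSolutionOn.abs_weight_le {s : ℝ → Fin M} {T : ℝ} {P : ℝ → Fin N → ℝ}
    {A : ℝ → Fin N → Fin N → ℝ} (h : IsProtocolSolutionOn gen δ β G s T P A)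
    (hβ : ∀ i j, 0 < β i j) (hβs : ∀ i j, β i j = β j i) (hc : ∀ i, 0 < (gen i).c) (hδ : 0 < δ)
    (hQ : IsOptimalDispatch gen δ D Q) (hP : ∑ i, P 0 i = D) (hA : AdmissibleWeights G (A 0))
    {t : ℝ} (ht : t ∈ Ico 0 T) (i j : Fin N) :
    |A t i j| ≤ weightBound gen δ β G Q (P 0) (A 0) := by
  have hPt : P t ∈ dispatchSet gen D :=
    ⟨h.withinLimits t ht, (h.sum_power hβs hA.1 ht).trans hP⟩
  have h₁ : |A t i j| ≤ |A 0 i j| + √(4 * β i j * energy gen δ β G 1 (A 0) Q (P 0) (A 0)) := by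
    by_cases hij : ∃ k, (G k).Adj i j
    · obtain ⟨k, hk⟩ := hij
      have hb := (energy_lower_bounds (G := G) hβ hc hδ hQ zero_le_one (A 0) hPt (A t)).2.2 k i j hk
      have he := h.energy_le hβ hβs hA.1 (γ := 1) zero_le_one (θ := A 0)
        (fun k i j hij => (hA.2 k i j hij).le) Q ht
      have hβ' := hβ i j
      have hsq : (A 0 i j - A t i j) ^ 2 ≤
          4 * β i j * energy gen δ β G 1 (A 0) Q (P 0) (A 0) := by
        have := hb.trans he
        rw [div_mul_eq_mul_div, one_mul, div_le_iff₀ (by positivity)] at this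
        linarith
      have := Real.abs_le_sqrt hsq
      rw [abs_sub_comm] at this
      calc |A t i j| = |A 0 i j + (A t i j - A 0 i j)| := by ring_nf
        _ ≤ |A 0 i j| + |A t i j - A 0 i j| := abs_add_le _ _
        _ ≤ _ := by linarith
    · push Not at hij
      rw [h.weight_eq ht hij]
      exact le_add_of_nonneg_right (Real.sqrt_nonneg _)
  have h₀ : ∀ i j, 0 ≤ |A 0 i j| + √(4 * β i j * energy gen δ β G 1 (A 0) Q (P 0) (A 0)) :=
    fun i j => by positivity
  have h₂ := Finset.single_le_sum (s := Finset.univ)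
    (f := fun j => |A 0 i j| + √(4 * β i j * energy gen δ β G 1 (A 0) Q (P 0) (A 0)))
    (fun j _ => h₀ i j) (Finset.mem_univ j)
  have h₃ := Finset.single_le_sum (s := Finset.univ)
    (f := fun i => ∑ j, (|A 0 i j| + √(4 * β i j * energy gen δ β G 1 (A 0) Q (P 0) (A 0))))
    (fun i _ => Finset.sum_nonneg fun j _ => h₀ i j) (Finset.mem_univ i)
  exact h₁.trans (h₂.trans h₃)

end Energy

/-! ### Invariance of the feasible set -/

section Invariance

variable {gen : Fin N → Generator} {δ D : ℝ} {β : Fin N → Fin N → ℝ}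
  {G : Fin M → SimpleGraph (Fin N)} {s : ℝ → Fin M}
  {P : ℝ → Fin N → ℝ} {A : ℝ → Fin N → Fin N → ℝ}

theorem isOpen_withinLimits (gen : Fin N → Generator) : IsOpen {P | WithinLimits gen P} := by
  simp only [WithinLimits, ofPred_forall]
  refine isOpen_iInter_of_finite fun i => ?_
  exact (isOpen_lt continuous_const (continuous_apply i)).inter
    (isOpen_lt (continuous_apply i) continuous_const)

theorem isClosed_withinMargin (gen : Fin N → Generator) (m : ℝ) :
    IsClosed {P | WithinMargin gen m P} := by
  simp only [WithinMargin, ofPred_forall]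
  refine isClosed_iInter fun i => ?_
  exact (isClosed_le continuous_const (continuous_apply i)).inter
    (isClosed_le (continuous_apply i) continuous_const)

namespace IsProtocolSolution

theorem restrict (h : IsProtocolSolution gen δ β G s P A) {T : ℝ}
    (hT : ∀ t ∈ Ico 0 T, WithinLimits gen (P t)) : IsProtocolSolutionOn gen δ β G s T P A where
  continuousOn_power i := (h.continuousOn_power i).mono Ico_subset_Ici_self
  continuousOn_weight i j := (h.continuousOn_weight i j).mono Ico_subset_Ici_self
  power_deriv t ht := h.power_deriv t ht.1
  weight_deriv t ht := h.weight_deriv t ht.1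
  withinLimits := hT

/-- A solution keeps the margin that is enforced by its initial cost. -/
theorem withinMargin (h : IsProtocolSolution gen δ β G s P A)
    (hβ : ∀ i j, 0 < β i j) (hβs : ∀ i j, β i j = β j i) (hA : AdmissibleWeights G (A 0))
    (hP : WithinLimits gen (P 0)) {m E : ℝ} (hm : 0 < m)
    (hmE : ∀ R, WithinLimits gen R → totalCost gen δ R ≤ E → WithinMargin gen m R)
    (hE : totalCost gen δ (P 0) ≤ E) {t : ℝ} (ht : 0 ≤ t) : WithinMargin gen m (P t) := by
  refine mem_of_invariance (f := P) (U := {P | WithinLimits gen P})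
    (K := {P | WithinMargin gen m P}) (continuousOn_pi.2 h.continuousOn_power)
    (isOpen_withinLimits gen) (isClosed_withinMargin gen m) (fun R hR => hR.withinLimits hm) hP
    (fun T _ hU τ hτ => ?_) t ht
  exact hmE _ (hU τ hτ) (((h.restrict hU).totalCost_le hβ hβs hA hτ).trans hE)

/-- A solution with admissible initial data stays within the capacity limits. -/
theorem solutionOn (h : IsProtocolSolution gen δ β G s P A) (hc : ∀ i, 0 < (gen i).c)
    (hδ : 0 < δ) (hβ : ∀ i j, 0 < β i j) (hβs : ∀ i j, β i j = β j i)
    (hA : AdmissibleWeights G (A 0)) (hP : WithinLimits gen (P 0)) (T : ℝ) :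
    IsProtocolSolutionOn gen δ β G s T P A := by
  obtain ⟨m, hm, hmE⟩ := exists_margin_of_totalCost_le gen hc hδ (totalCost gen δ (P 0))
  exact h.restrict fun t ht =>
    (h.withinMargin hβ hβs hA hP hm hmE le_rfl ht.1).withinLimits hm

end IsProtocolSolution

end Invariance

/-! ### Existence and uniqueness -/

/-! ### Calculus of bounded Lipschitz maps -/

section BoundedLipschitz

variable {X F : Type*} [PseudoMetricSpace X] [SeminormedAddCommGroup F]

/-- Bounded Lipschitz maps. -/
def BoundedLipschitz (f : X → F) : Prop :=
  ∃ C : ℝ, 0 ≤ C ∧ (∀ x, ‖f x‖ ≤ C) ∧ ∀ x y, ‖f x - f y‖ ≤ C * dist x y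

namespace BoundedLipschitz

theorem of_bounds {f : X → F} {C K : ℝ} (hC : 0 ≤ C) (h₁ : ∀ x, ‖f x‖ ≤ C)
    (h₂ : ∀ x y, ‖f x - f y‖ ≤ K * dist x y) : BoundedLipschitz f :=
  ⟨max C K, hC.trans (le_max_left _ _), fun x => (h₁ x).trans (le_max_left _ _), fun x y =>
    (h₂ x y).trans (mul_le_mul_of_nonneg_right (le_max_right _ _) dist_nonneg)⟩

theorem const (c : F) : BoundedLipschitz fun _ : X => c :=
  of_bounds (norm_nonneg c) (fun _ => le_rfl) (K := 0) fun _ _ => by simp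

theorem sub {f g : X → F} (hf : BoundedLipschitz f) (hg : BoundedLipschitz g) :
    BoundedLipschitz fun x => f x - g x := by
  obtain ⟨C, hC, h₁, h₂⟩ := hf
  obtain ⟨C', hC', h₁', h₂'⟩ := hg
  refine ⟨C + C', by positivity, fun x => (norm_sub_le _ _).trans (add_le_add (h₁ x) (h₁' x)),
    fun x y => ?_⟩
  calc ‖f x - g x - (f y - g y)‖ = ‖(f x - f y) - (g x - g y)‖ := by
        congr 1
        abel
    _ ≤ ‖f x - f y‖ + ‖g x - g y‖ := norm_sub_le _ _
    _ ≤ (C + C') * dist x y := by linarith [h₂ x y, h₂' x y]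

theorem add {f g : X → F} (hf : BoundedLipschitz f) (hg : BoundedLipschitz g) :
    BoundedLipschitz fun x => f x + g x := by
  have h0 : BoundedLipschitz fun _ : X => (0 : F) := const 0
  simpa using hf.sub (h0.sub hg)

theorem sum {ι : Type*} (S : Finset ι) {f : ι → X → F} (hf : ∀ i, BoundedLipschitz (f i)) :
    BoundedLipschitz fun x => ∑ i ∈ S, f i x := by
  classical
  induction S using Finset.induction_on with
  | empty => simpa using const (X := X) (0 : F)
  | insert i S hi ih => simpa [Finset.sum_insert hi] using (hf i).add ih

/-- Products are the reason to require boundedness as well: the field multiplies weights with cost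
differences, and Lipschitz maps alone are not closed under products. -/
theorem mul {f g : X → ℝ} (hf : BoundedLipschitz f) (hg : BoundedLipschitz g) :
    BoundedLipschitz fun x => f x * g x := by
  obtain ⟨C, hC, h₁, h₂⟩ := hf
  obtain ⟨C', hC', h₁', h₂'⟩ := hg
  refine of_bounds (C := C * C') (K := C * C' + C * C') (by positivity) (fun x => ?_)
    fun x y => ?_
  · rw [norm_mul]
    exact mul_le_mul (h₁ x) (h₁' x) (norm_nonneg _) hC
  · calc ‖f x * g x - f y * g y‖ = ‖f x * (g x - g y) + (f x - f y) * g y‖ := by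
          congr 1
          ring
      _ ≤ ‖f x‖ * ‖g x - g y‖ + ‖f x - f y‖ * ‖g y‖ := by
          rw [← norm_mul, ← norm_mul]
          exact norm_add_le _ _
      _ ≤ C * (C' * dist x y) + C * dist x y * C' := by
          gcongr
          exacts [h₁ x, h₂' x y, h₂ x y, h₁' y]
      _ = _ := by ring

theorem ite {f g : X → F} (p : Prop) [Decidable p] (hf : BoundedLipschitz f)
    (hg : BoundedLipschitz g) : BoundedLipschitz fun x => if p then f x else g x := by
  split_ifs
  exacts [hf, hg]

theorem pi {ι : Type*} [Fintype ι] {f : X → ι → F} (hf : ∀ i, BoundedLipschitz fun x => f x i) :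
    BoundedLipschitz f := by
  choose C hC h₁ h₂ using hf
  have hle : ∀ i, C i ≤ ∑ j, C j := fun i =>
    Finset.single_le_sum (fun j _ => hC j) (Finset.mem_univ i)
  have h₀ : 0 ≤ ∑ j, C j := Finset.sum_nonneg fun j _ => hC j
  refine ⟨∑ j, C j, h₀, fun x => (pi_norm_le_iff_of_nonneg h₀).2 fun i => (h₁ i x).trans (hle i),
    fun x y => (pi_norm_le_iff_of_nonneg (by positivity)).2 fun i => (h₂ i x y).trans ?_⟩
  exact mul_le_mul_of_nonneg_right (hle i) dist_nonneg

theorem prodMk {F' : Type*} [SeminormedAddCommGroup F'] {f : X → F} {g : X → F'}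
    (hf : BoundedLipschitz f) (hg : BoundedLipschitz g) :
    BoundedLipschitz fun x => (f x, g x) := by
  obtain ⟨C, hC, h₁, h₂⟩ := hf
  obtain ⟨C', hC', h₁', h₂'⟩ := hg
  refine ⟨max C C', hC.trans (le_max_left _ _), fun x => ?_, fun x y => ?_⟩
  · exact max_le_max (h₁ x) (h₁' x)
  · rw [max_mul_of_nonneg _ _ dist_nonneg]
    exact max_le_max (h₂ x y) (h₂' x y)

/-- Common constants for finitely many bounded Lipschitz maps. -/
theorem exists_uniform {ι : Type*} [Finite ι] {f : ι → X → F} (hf : ∀ k, BoundedLipschitz (f k)) :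
    ∃ C : NNReal, (∀ k x, ‖f k x‖ ≤ C) ∧ ∀ k, LipschitzWith C (f k) := by
  cases nonempty_fintype ι
  obtain ⟨C, hC, h₁, h₂⟩ := pi (f := fun x k => f k x) hf
  refine ⟨⟨C, hC⟩, fun k x => (norm_le_pi_norm (fun k => f k x) k).trans (h₁ x),
    fun k => LipschitzWith.of_dist_le_mul fun x y => ?_⟩
  rw [dist_eq_norm]
  exact (norm_le_pi_norm ((fun k => f k x) - fun k => f k y) k).trans (h₂ x y)

end BoundedLipschitz

end BoundedLipschitz

/-! ### Clipping to an interval -/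

section Clip

/-- The projection of the line onto the interval from `lo` to `hi`. -/
def clip (lo hi x : ℝ) : ℝ := max lo (min hi x)

theorem clip_of_mem {lo hi x : ℝ} (h₁ : lo ≤ x) (h₂ : x ≤ hi) : clip lo hi x = x := by
  simp [clip, h₁, h₂]

theorem le_clip (lo hi x : ℝ) : lo ≤ clip lo hi x := le_max_left _ _

theorem clip_le {lo hi : ℝ} (h : lo ≤ hi) (x : ℝ) : clip lo hi x ≤ hi :=
  max_le h (min_le_left _ _)

theorem abs_clip_sub_clip_le (lo hi x y : ℝ) : |clip lo hi x - clip lo hi y| ≤ |x - y| := by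
  unfold clip
  calc _ ≤ |min hi x - min hi y| := by
        simpa using abs_max_sub_max_le_max lo (min hi x) lo (min hi y)
    _ ≤ |x - y| := by
        simpa using abs_min_sub_min_le_max hi x hi y

theorem boundedLipschitz_clip {lo hi : ℝ} (h : lo ≤ hi) : BoundedLipschitz (clip lo hi) := by
  refine BoundedLipschitz.of_bounds (C := max |lo| |hi|) (K := 1) (by positivity) (fun x => ?_)
    fun x y => ?_
  · exact abs_le_max_abs_abs (le_clip lo hi x) (clip_le h x)
  · rw [one_mul]
    exact abs_clip_sub_clip_le lo hi x y

theorem BoundedLipschitz.comp_lipschitz {X Y F : Type*} [PseudoMetricSpace X] [PseudoMetricSpace Y]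
    [SeminormedAddCommGroup F] {f : Y → F} (hf : BoundedLipschitz f) {g : X → Y}
    (hg : ∀ x y, dist (g x) (g y) ≤ dist x y) : BoundedLipschitz fun x => f (g x) := by
  obtain ⟨C, hC, h₁, h₂⟩ := hf
  exact ⟨C, hC, fun x => h₁ _, fun x y =>
    (h₂ _ _).trans (mul_le_mul_of_nonneg_left (hg x y) hC)⟩

end Clip

/-! ### The clipped protocol -/

section ClippedField

/-- The state space of the protocol. -/
abbrev ProtocolState (N : ℕ) : Type := (Fin N → ℝ) × (Fin N → Fin N → ℝ)

variable {gen : Fin N → Generator} {δ D : ℝ} {β : Fin N → Fin N → ℝ}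
  {G : Fin M → SimpleGraph (Fin N)} {s : ℝ → Fin M}

/-- The incremental costs of the dispatch that is clipped to the margin `m`. -/
noncomputable def clippedCost (gen : Fin N → Generator) (δ m : ℝ) (x : ProtocolState N)
    (i : Fin N) : ℝ :=
  (gen i).incrementalCost δ (clip ((gen i).pmin + m) ((gen i).pmax - m) (x.1 i))

open Classical in
/-- The vector field of the protocol, with power outputs clipped to the margin `m` and
weights clipped to `[-R, R]`. -/
noncomputable def clippedField (gen : Fin N → Generator) (δ : ℝ) (β : Fin N → Fin N → ℝ)
    (m R : ℝ) (H : SimpleGraph (Fin N)) (x : ProtocolState N) : ProtocolState N :=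
  (fun i => ∑ j, if H.Adj i j then
    clip (-R) R (x.2 i j) * (clippedCost gen δ m x j - clippedCost gen δ m x i) else 0,
   fun i j => if H.Adj i j then
    β i j * (clippedCost gen δ m x i - clippedCost gen δ m x j) ^ 2 else 0)

/-- Clipped outputs stay in the margin, away from the poles of the incremental cost, where it is
Lipschitz. -/
theorem boundedLipschitz_clippedCost {m : ℝ} (hc : ∀ i, 0 < (gen i).c) (hδ : 0 < δ) (hm : 0 < m)
    (i : Fin N) (hi : (gen i).pmin + m ≤ (gen i).pmax - m) :
    BoundedLipschitz fun x : ProtocolState N => clippedCost gen δ m x i := by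
  have h : BoundedLipschitz fun p : ℝ =>
      (gen i).incrementalCost δ (clip ((gen i).pmin + m) ((gen i).pmax - m) p) := by
    obtain ⟨C, hC, h₁, h₂⟩ := boundedLipschitz_clip hi
    have hΛ := ((gen i).slopeBound_pos (m := m) (hc i) hδ).le
    have hmem : ∀ p, (gen i).pmin + m ≤ clip ((gen i).pmin + m) ((gen i).pmax - m) p ∧
        clip ((gen i).pmin + m) ((gen i).pmax - m) p ≤ (gen i).pmax - m := fun p =>
      ⟨le_clip _ _ _, clip_le hi _⟩
    have hL : ∀ p q, |(gen i).incrementalCost δ (clip ((gen i).pmin + m) ((gen i).pmax - m) p) -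
        (gen i).incrementalCost δ (clip ((gen i).pmin + m) ((gen i).pmax - m) q)| ≤
        (gen i).slopeBound δ m * |clip ((gen i).pmin + m) ((gen i).pmax - m) p -
          clip ((gen i).pmin + m) ((gen i).pmax - m) q| := fun p q =>
      (gen i).abs_incrementalCost_sub_le (hc i) hδ hm (hmem p) (hmem q)
    refine BoundedLipschitz.of_bounds
      (C := |(gen i).incrementalCost δ (clip ((gen i).pmin + m) ((gen i).pmax - m) 0)| +
        (gen i).slopeBound δ m * (C + C)) (K := (gen i).slopeBound δ m) (by positivity)
      (fun p => ?_) fun p q => ?_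
    · have h₃ := hL p 0
      have h₄ : |clip ((gen i).pmin + m) ((gen i).pmax - m) p -
          clip ((gen i).pmin + m) ((gen i).pmax - m) 0| ≤ C + C :=
        (abs_sub _ _).trans (add_le_add (h₁ p) (h₁ 0))
      have h₅ := h₃.trans (mul_le_mul_of_nonneg_left h₄ hΛ)
      have h₆ := abs_sub_abs_le_abs_sub
        ((gen i).incrementalCost δ (clip ((gen i).pmin + m) ((gen i).pmax - m) p))
        ((gen i).incrementalCost δ (clip ((gen i).pmin + m) ((gen i).pmax - m) 0))
      rw [Real.norm_eq_abs]
      linarith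
    · exact (hL p q).trans (mul_le_mul_of_nonneg_left (abs_clip_sub_clip_le _ _ p q) hΛ)
  exact h.comp_lipschitz (g := fun x : ProtocolState N => x.1 i) fun x y =>
    (dist_le_pi_dist x.1 y.1 i).trans (le_max_left _ _)

theorem boundedLipschitz_clippedField {m R : ℝ} (hc : ∀ i, 0 < (gen i).c) (hδ : 0 < δ)
    (hm : 0 < m) (hR : 0 ≤ R) (hi : ∀ i, (gen i).pmin + m ≤ (gen i).pmax - m)
    (H : SimpleGraph (Fin N)) : BoundedLipschitz (clippedField gen δ β m R H) := by
  classical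
  have hw := fun i => boundedLipschitz_clippedCost hc hδ hm i (hi i)
  have ha : ∀ i j, BoundedLipschitz fun x : ProtocolState N => clip (-R) R (x.2 i j) :=
    fun i j => (boundedLipschitz_clip (by linarith)).comp_lipschitz
      (g := fun x : ProtocolState N => x.2 i j) fun x y =>
        ((dist_le_pi_dist (x.2 i) (y.2 i) j).trans (dist_le_pi_dist x.2 y.2 i)).trans
          (le_max_right _ _)
  have hz : BoundedLipschitz fun _ : ProtocolState N => (0 : ℝ) := .const 0
  refine .prodMk (.pi fun i => .sum _ fun j => .ite _ ((ha i j).mul ((hw j).sub (hw i))) hz)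
    (.pi fun i => .pi fun j => .ite _ ?_ hz)
  simp only [pow_two]
  exact (BoundedLipschitz.const (β i j)).mul (((hw i).sub (hw j)).mul ((hw i).sub (hw j)))

theorem clippedCost_eq {m : ℝ} {x : ProtocolState N} (hx : WithinMargin gen m x.1) (i : Fin N) :
    clippedCost gen δ m x i = incCost gen δ x.1 i := by
  unfold clippedCost incCost
  rw [clip_of_mem (hx i).1 (hx i).2]

open Classical in
theorem clippedField_eq {m R : ℝ} {x : ProtocolState N} (hx : WithinMargin gen m x.1)
    (hR : ∀ i j, |x.2 i j| ≤ R) (H : SimpleGraph (Fin N)) :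
    clippedField gen δ β m R H x =
      (fun i => ∑ j, if H.Adj i j then
        x.2 i j * (incCost gen δ x.1 j - incCost gen δ x.1 i) else 0,
       fun i j => if H.Adj i j then
        β i j * (incCost gen δ x.1 i - incCost gen δ x.1 j) ^ 2 else 0) := by
  have h : ∀ i j, clip (-R) R (x.2 i j) = x.2 i j := fun i j =>
    clip_of_mem (abs_le.1 (hR i j)).1 (abs_le.1 (hR i j)).2
  unfold clippedField
  simp only [clippedCost_eq hx, h]

/-- Existence and uniqueness for the switched protocol. -/
theorem exists_unique_protocolSolution (hc : ∀ i, 0 < (gen i).c) (hδ : 0 < δ)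
    (hβ : ∀ i j, 0 < β i j) (hβs : ∀ i j, β i j = β j i) {Q : Fin N → ℝ}
    (hQ : IsOptimalDispatch gen δ D Q) (hs : IsSwitchingSignal s) {P₀ : Fin N → ℝ}
    (hP₀ : P₀ ∈ dispatchSet gen D) {A₀ : Fin N → Fin N → ℝ} (hA₀ : AdmissibleWeights G A₀) :
    ∃ P A, (IsProtocolSolution gen δ β G s P A ∧ P 0 = P₀ ∧ A 0 = A₀) ∧
      ∀ P' A', IsProtocolSolution gen δ β G s P' A' → P' 0 = P₀ → A' 0 = A₀ →
        ∀ t, 0 ≤ t → P' t = P t ∧ A' t = A t := by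
  classical
  obtain ⟨m, hm, hmE⟩ := exists_margin_of_totalCost_le gen hc hδ (totalCost gen δ P₀)
  have hm₀ := hmE P₀ hP₀.1 le_rfl
  set R := weightBound gen δ β G Q P₀ A₀ with hR
  have hR₀ : 0 ≤ R := Finset.sum_nonneg fun i _ => Finset.sum_nonneg fun j _ => by positivity
  have hAR : ∀ i j, |A₀ i j| ≤ R := by
    intro i j
    have h₁ := Finset.single_le_sum (s := Finset.univ)
      (f := fun j => |A₀ i j| + √(4 * β i j * energy gen δ β G 1 A₀ Q P₀ A₀))
      (fun j _ => by positivity) (Finset.mem_univ j)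
    have h₂ := Finset.single_le_sum (s := Finset.univ)
      (f := fun i => ∑ j, (|A₀ i j| + √(4 * β i j * energy gen δ β G 1 A₀ Q P₀ A₀)))
      (fun i _ => Finset.sum_nonneg fun j _ => by positivity) (Finset.mem_univ i)
    exact ((le_add_of_nonneg_right (Real.sqrt_nonneg _)).trans h₁).trans h₂
  -- The clipping thresholds `m / 2` and `R + 1` are strictly looser than the a priori bounds `m`
  -- and `R`, so the region `K` of those bounds lies in an open set `U` on which clipping does
  -- nothing.
  set v : Fin M → ProtocolState N → ProtocolState N :=
    fun k => clippedField gen δ β (m / 2) (R + 1) (G k) with hv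
  obtain ⟨C, hC₁, hC₂⟩ := BoundedLipschitz.exists_uniform (f := v) fun k =>
    boundedLipschitz_clippedField hc hδ (half_pos hm) (by linarith)
      (fun i => by linarith [(hm₀ i).1, (hm₀ i).2]) (G k)
  obtain ⟨f, hf₀, hfc, hfd⟩ := exists_global_switched_solution hC₂ hC₁ hs (P₀, A₀)
  set U : Set (ProtocolState N) := {x | (∀ i, (gen i).pmin + m / 2 < x.1 i ∧
    x.1 i < (gen i).pmax - m / 2) ∧ ∀ i j, |x.2 i j| < R + 1} with hU
  set K : Set (ProtocolState N) := {x | WithinMargin gen m x.1 ∧ ∀ i j, |x.2 i j| ≤ R} with hK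
  have hUo : IsOpen U := by
    simp only [hU, ofPred_and, ofPred_forall]
    refine IsOpen.inter (isOpen_iInter_of_finite fun i => ?_)
      (isOpen_iInter_of_finite fun i => isOpen_iInter_of_finite fun j => ?_)
    · exact (isOpen_lt (by fun_prop) (by fun_prop)).inter (isOpen_lt (by fun_prop) (by fun_prop))
    · exact isOpen_lt (by fun_prop) (by fun_prop)
  have hKc : IsClosed K := by
    simp only [hK, ofPred_and, ofPred_forall]
    refine IsClosed.inter ((isClosed_withinMargin gen m).preimage continuous_fst)
      (isClosed_iInter fun i => isClosed_iInter fun j => ?_)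
    exact isClosed_le (by fun_prop) (by fun_prop)
  have hKU : K ⊆ U := fun x hx => ⟨fun i => ⟨by linarith [(hx.1 i).1], by linarith [(hx.1 i).2]⟩,
    fun i j => by linarith [hx.2 i j]⟩
  have hUm : ∀ x ∈ U, WithinMargin gen (m / 2) x.1 := fun x hx i =>
    ⟨(hx.1 i).1.le, (hx.1 i).2.le⟩
  have hcont₁ : ∀ i, ContinuousOn (fun t => (f t).1 i) (Ici 0) := fun i =>
    (by fun_prop : Continuous fun x : ProtocolState N => x.1 i).comp_continuousOn hfc
  have hcont₂ : ∀ i j, ContinuousOn (fun t => (f t).2 i j) (Ici 0) := fun i j =>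
    (by fun_prop : Continuous fun x : ProtocolState N => x.2 i j).comp_continuousOn hfc
  have hval : ∀ t, f t ∈ U → v (s t) (f t) = _ := fun t hft =>
    clippedField_eq (hUm _ hft) (fun i j => (hft.2 i j).le) (G (s t))
  have hd₁ : ∀ t, 0 ≤ t → f t ∈ U → ∀ i, HasDerivWithinAt (fun τ => (f τ).1 i)
      (∑ j, if (G (s t)).Adj i j then
        (f t).2 i j * (incCost gen δ (f t).1 j - incCost gen δ (f t).1 i) else 0) (Ici t) t := by
    intro t ht hft i
    have h := hfd t ht
    rw [hval t hft] at h
    exact hasDerivWithinAt_pi.1 h.fst i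
  have hd₂ : ∀ t, 0 ≤ t → f t ∈ U → ∀ i j, HasDerivWithinAt (fun τ => (f τ).2 i j)
      (if (G (s t)).Adj i j then
        β i j * (incCost gen δ (f t).1 i - incCost gen δ (f t).1 j) ^ 2 else 0) (Ici t) t := by
    intro t ht hft i j
    have h := hfd t ht
    rw [hval t hft] at h
    exact hasDerivWithinAt_pi.1 (hasDerivWithinAt_pi.1 h.snd i) j
  -- While in `U` the trajectory solves the true protocol, so cost and energy monotonicity place it
  -- in `K`.
  have hfK : ∀ t, 0 ≤ t → f t ∈ K := by
    refine mem_of_invariance hfc hUo hKc hKU (hKU ?_) fun T hT hTU t ht => ?_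
    · rw [hf₀]
      exact ⟨hm₀, hAR⟩
    · have hsol : IsProtocolSolutionOn gen δ β G s T (fun t => (f t).1) (fun t => (f t).2) :=
        { continuousOn_power := fun i => (hcont₁ i).mono Ico_subset_Ici_self
          continuousOn_weight := fun i j => (hcont₂ i j).mono Ico_subset_Ici_self
          power_deriv := fun t ht i => hd₁ t ht.1 (hTU t ht) i
          weight_deriv := fun t ht i j => hd₂ t ht.1 (hTU t ht) i j
          withinLimits := fun t ht => (hUm _ (hTU t ht)).withinLimits (half_pos hm) }
      have hA' : AdmissibleWeights G ((fun t => (f t).2) 0) := by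
        simp only [hf₀]
        exact hA₀
      have h₁ := hsol.totalCost_le hβ hβs hA' ht
      have h₂ := hsol.abs_weight_le hβ hβs hc hδ hQ (by simp only [hf₀]; exact hP₀.2) hA' ht
      simp only [hf₀] at h₁ h₂
      exact ⟨hmE _ (hsol.withinLimits t ht) h₁, h₂⟩
  refine ⟨fun t => (f t).1, fun t => (f t).2, ⟨⟨hcont₁, hcont₂,
    fun t ht i => hd₁ t ht (hKU (hfK t ht)) i, fun t ht i j => hd₂ t ht (hKU (hfK t ht)) i j⟩,
    by simp only [hf₀], by simp only [hf₀]⟩, ?_⟩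
  intro P' A' h hP' hA' t ht
  have hAd : AdmissibleWeights G (A' 0) := hA'.symm ▸ hA₀
  have hPd : WithinLimits gen (P' 0) := hP'.symm ▸ hP₀.1
  -- Any other solution obeys the same a priori bounds, hence also solves the clipped equation,
  -- where uniqueness is known.
  have hmem : ∀ τ, 0 ≤ τ → WithinMargin gen (m / 2) (P' τ) ∧ ∀ i j, |A' τ i j| ≤ R + 1 := by
    intro τ hτ
    have h₁ := h.withinMargin hβ hβs hAd hPd hm hmE (by rw [hP']) hτ
    refine ⟨h₁.mono (by linarith), fun i j => ?_⟩
    have h₂ := (h.solutionOn hc hδ hβ hβs hAd hPd (τ + 1)).abs_weight_le hβ hβs hc hδ hQ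
      (by rw [hP']; exact hP₀.2) hAd ⟨hτ, by linarith⟩ i j
    rw [hP', hA'] at h₂
    linarith
  have hg : IsSwitchedSolution v s t fun τ => (P' τ, A' τ) := by
    refine ⟨ContinuousOn.mono ?_ (Icc_subset_Ici_self : Icc 0 t ⊆ Ici 0), fun τ hτ => ?_⟩
    · exact (continuousOn_pi.2 h.continuousOn_power).prodMk
        (continuousOn_pi.2 fun i => continuousOn_pi.2 fun j => h.continuousOn_weight i j)
    · have hτ' := hmem τ hτ.1
      change HasDerivWithinAt _ (clippedField gen δ β (m / 2) (R + 1) (G (s τ)) (P' τ, A' τ)) _ _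
      rw [clippedField_eq (x := (P' τ, A' τ)) hτ'.1 hτ'.2]
      exact (hasDerivWithinAt_pi.2 (h.power_deriv τ hτ.1)).prodMk
        (hasDerivWithinAt_pi.2 fun i => hasDerivWithinAt_pi.2 (h.weight_deriv τ hτ.1 i))
  have hfs : IsSwitchedSolution v s t f :=
    ⟨hfc.mono Icc_subset_Ici_self, fun τ hτ => hfd τ hτ.1⟩
  have heq := hg.eqOn hC₂ hfs (by simp only [hP', hA', hf₀]) (right_mem_Icc.2 ht)
  exact ⟨congrArg Prod.fst heq, congrArg Prod.snd heq⟩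

end ClippedField

/-! ### Exponential decay -/

section Decay

variable {gen : Fin N → Generator} {δ D : ℝ} {β : Fin N → Fin N → ℝ}
  {G : Fin M → SimpleGraph (Fin N)}

theorem exists_pos_le_of_finite {ι : Type*} [Finite ι] {f : ι → ℝ} (hf : ∀ i, 0 < f i) :
    ∃ c, 0 < c ∧ ∀ i, c ≤ f i := by
  rcases isEmpty_or_nonempty ι with _ | _
  · exact ⟨1, one_pos, fun i => isEmptyElim i⟩
  · obtain ⟨i, hi⟩ := Finite.exists_min f
    exact ⟨f i, hf i, hi⟩

/-- By compactness, a margin on the initial outputs becomes a bound on the initial cost, the form in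
which `exists_exponential_decay` takes it. -/
theorem exists_totalCost_bound (gen : Fin N → Generator) (δ : ℝ) {μ : ℝ} (hμ : 0 < μ) :
    ∃ E, ∀ P, WithinMargin gen μ P → totalCost gen δ P ≤ E := by
  have h : ∀ i, ∃ C, ∀ p ∈ Icc ((gen i).pmin + μ) ((gen i).pmax - μ),
      ‖(gen i).barrierCost δ p‖ ≤ C := fun i =>
    isCompact_Icc.exists_bound_of_continuousOn fun p hp =>
      ((gen i).continuousAt_barrierCost δ
        ⟨by linarith [hp.1], by linarith [hp.2]⟩).continuousWithinAt
  choose C hC using h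
  exact ⟨∑ i, C i, fun P hP => Finset.sum_le_sum fun i _ =>
    (le_abs_self _).trans (hC i (P i) (hP i))⟩

/-- The excess of the total modified cost over its value at `Q`. -/
noncomputable def excessCost (gen : Fin N → Generator) (δ : ℝ) (Q P : Fin N → ℝ) : ℝ :=
  ∑ i, ((gen i).barrierCost δ (P i) - (gen i).barrierCost δ (Q i))

theorem excessCost_eq (gen : Fin N → Generator) (δ : ℝ) (Q P : Fin N → ℝ) :
    excessCost gen δ Q P = totalCost gen δ P - totalCost gen δ Q :=
  Finset.sum_sub_distrib _ _

/-- The excess cost decays exponentially and is equivalent to the squared consensus error,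
uniformly for bounded initial costs and initial weights bounded below. -/
theorem exists_exponential_decay (hc : ∀ i, 0 < (gen i).c) (hδ : 0 < δ)
    (hβ : ∀ i j, 0 < β i j) (hβs : ∀ i j, β i j = β j i) (hG : ∀ k, (G k).Connected)
    {Q : Fin N → ℝ} (hQ : IsOptimalDispatch gen δ D Q) (E : ℝ) {α : ℝ} (hα : 0 < α) :
    ∃ K : ℝ, 0 < K ∧ ∃ r : ℝ, 0 < r ∧ ∀ s : ℝ → Fin M, ∀ P A,
      IsProtocolSolution gen δ β G s P A → P 0 ∈ dispatchSet gen D → AdmissibleWeights G (A 0) →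
      totalCost gen δ (P 0) ≤ E → (∀ k i j, (G k).Adj i j → α ≤ A 0 i j) → ∀ t, 0 ≤ t →
      P t ∈ dispatchSet gen D ∧
      excessCost gen δ Q (P t) ≤ Real.exp (-r * t) * excessCost gen δ Q (P 0) ∧
      ∑ i, consensusError gen δ (P t) i ^ 2 ≤ K * excessCost gen δ Q (P t) ∧
      excessCost gen δ Q (P t) ≤ K * ∑ i, consensusError gen δ (P t) i ^ 2 := by
  -- The maximum makes the margin valid for `Q` as well as for the trajectory.
  obtain ⟨m, hm, hmE⟩ := exists_margin_of_totalCost_le gen hc hδ (max E (totalCost gen δ Q))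
  obtain ⟨c₀, hc₀, hc₀le⟩ := exists_pos_le_of_finite hc
  obtain ⟨C, hC, hPoin⟩ := exists_poincare G hG
  have hQm : WithinMargin gen m Q := hmE Q hQ.1.1 (le_max_right _ _)
  set Λ : ℝ := ∑ i, (gen i).slopeBound δ m with hΛdef
  have hΛ : ∀ i, (gen i).slopeBound δ m ≤ Λ := fun i =>
    Finset.single_le_sum (f := fun i => (gen i).slopeBound δ m)
      (fun j _ => ((gen j).slopeBound_pos (hc j) hδ).le) (Finset.mem_univ i)
  -- `K` covers both directions of the equivalence. The rate combines the dissipation factor `α /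
  -- 2`, the Poincaré constant `C` and the factor `4 c₀` of the excess bound.
  refine ⟨max (Λ ^ 2 / c₀) (1 / (4 * c₀)), lt_max_of_lt_right (by positivity),
    α / 2 / C * (4 * c₀), by positivity, ?_⟩
  intro s P A h hP hA hE hαA t ht
  have hsol := h.solutionOn hc hδ hβ hβs hA hP.1
  have hmem : ∀ τ, 0 ≤ τ → P τ ∈ dispatchSet gen D := fun τ hτ =>
    ⟨(hsol (τ + 1)).withinLimits τ ⟨hτ, by linarith⟩,
      ((hsol (τ + 1)).sum_power hβs hA.1 ⟨hτ, by linarith⟩).trans hP.2⟩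
  have hmargin : WithinMargin gen m (P t) :=
    h.withinMargin hβ hβs hA hP.1 hm hmE (hE.trans (le_max_left _ _)) ht
  have hupper : ∀ τ, 0 ≤ τ → excessCost gen δ Q (P τ) ≤
      1 / (4 * c₀) * ∑ i, consensusError gen δ (P τ) i ^ 2 := fun τ hτ =>
    hQ.excess_le hδ hc₀ hc₀le (hmem τ hτ)
  have hlower := hQ.sum_consensusError_sq_le hδ hm hc₀ hc₀le hΛ (hmem t ht) hQm hmargin
  have hsq : 0 ≤ ∑ i, consensusError gen δ (P t) i ^ 2 := Finset.sum_nonneg fun i _ => sq_nonneg _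
  have hnn : 0 ≤ excessCost gen δ Q (P t) :=
    (Finset.sum_nonneg fun i _ => mul_nonneg (hc i).le (sq_nonneg _)).trans
      (hQ.quadratic_growth hδ (hmem t ht))
  refine ⟨hmem t ht, ?_, hlower.trans (mul_le_mul_of_nonneg_right (le_max_left _ _) hnn),
    (hupper t ht).trans (mul_le_mul_of_nonneg_right (le_max_right _ _) hsq)⟩
  have hsub : Icc 0 t ⊆ Ico 0 (t + 1) := fun x hx => ⟨hx.1, by linarith [hx.2]⟩
  refine exp_decay_of_right_deriv_le (f := fun τ => excessCost gen δ Q (P τ)) ht ?_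
    (f' := fun τ => -(1 / 2) * linkSum (G (s τ))
        (fun i j => A τ i j * (incCost gen δ (P τ) i - incCost gen δ (P τ) j) ^ 2))
    (fun τ hτ => ?_) (fun τ hτ => ?_)
  · simp only [excessCost_eq]
    exact ((hsol (t + 1)).continuousOn_totalCost.mono hsub).sub continuousOn_const
  · simp only [excessCost_eq]
    exact ((hsol (t + 1)).totalCost_deriv hβs hA.1 (hsub (Ico_subset_Icc_self hτ))).sub_const _
  · have h₁ : α * linkSum (G (s τ)) (fun i j =>
        (consensusError gen δ (P τ) i - consensusError gen δ (P τ) j) ^ 2) ≤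
        linkSum (G (s τ))
          (fun i j => A τ i j * (incCost gen δ (P τ) i - incCost gen δ (P τ) j) ^ 2) := by
      rw [← linkSum_const_mul]
      refine linkSum_le_linkSum fun i j hij => ?_
      rw [consensusError_sub]
      exact mul_le_mul_of_nonneg_right ((hαA _ i j hij).trans
        ((hsol (t + 1)).weight_mono hβ le_rfl hτ.1 (by linarith [hτ.2]) i j)) (sq_nonneg _)
    have h₂ := hPoin (s τ) _ (sum_consensusError gen δ (P τ))
    have h₃ := hupper τ hτ.1
    have h₄ : 4 * c₀ * excessCost gen δ Q (P τ) ≤ ∑ i, consensusError gen δ (P τ) i ^ 2 := by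
      rw [one_div, ← div_eq_inv_mul, le_div_iff₀ (by positivity)] at h₃
      linarith
    have h₅ := h₄.trans h₂
    have h₆ : α / 2 / C * (4 * c₀ * excessCost gen δ Q (P τ)) ≤ α / 2 * linkSum (G (s τ))
        (fun i j => (consensusError gen δ (P τ) i - consensusError gen δ (P τ) j) ^ 2) := by
      refine (mul_le_mul_of_nonneg_left h₅ (by positivity)).trans_eq ?_
      field_simp
    linarith

theorem tendsto_zero_of_mul_sq_le_exp {f : ℝ → ℝ} {c a r : ℝ} (hc : 0 < c) (hr : 0 < r)
    (h : ∀ t, 0 ≤ t → c * f t ^ 2 ≤ a * Real.exp (-r * t)) : Tendsto f atTop (𝓝 0) := by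
  have hexp : Tendsto (fun t : ℝ => a / c * Real.exp (-r * t)) atTop (𝓝 0) := by
    have : Tendsto (fun t : ℝ => -r * t) atTop atBot :=
      tendsto_id.const_mul_atTop_of_neg (neg_lt_zero.2 hr)
    simpa using (Real.tendsto_exp_atBot.comp this).const_mul (a / c)
  have hsq : Tendsto (fun t => f t ^ 2) atTop (𝓝 0) := by
    refine squeeze_zero' (Eventually.of_forall fun t => sq_nonneg _) ?_ hexp
    filter_upwards [eventually_ge_atTop 0] with t ht
    rw [div_mul_eq_mul_div, le_div_iff₀ hc, mul_comm]
    exact h t ht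
  have := hsq.sqrt
  simp only [Real.sqrt_sq_eq_abs, Real.sqrt_zero] at this
  exact (tendsto_zero_iff_abs_tendsto_zero f).2 this

theorem tendsto_of_monotoneOn_Ici_of_le {f : ℝ → ℝ} {B : ℝ} (hf : MonotoneOn f (Ici 0))
    (hB : ∀ t, 0 ≤ t → f t ≤ B) : ∃ l, Tendsto f atTop (𝓝 l) ∧ f 0 ≤ l := by
  -- Freezing `f` at its initial value for negative times makes it monotone on the whole line.
  have hmono : Monotone fun t => f (max 0 t) := fun a b hab =>
    hf (mem_Ici.2 (le_max_left _ _)) (mem_Ici.2 (le_max_left _ _)) (max_le_max le_rfl hab)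
  have hbdd : BddAbove (range fun t => f (max 0 t)) := by
    refine ⟨B, ?_⟩
    rintro _ ⟨t, rfl⟩
    exact hB _ (le_max_left _ _)
  refine ⟨_, (tendsto_atTop_ciSup hmono hbdd).congr' ?_, ?_⟩
  · filter_upwards [eventually_ge_atTop 0] with t ht
    rw [max_eq_right ht]
  · simpa using le_ciSup hbdd 0

theorem AdmissibleWeights.exists_lower_bound {A : Fin N → Fin N → ℝ} (hA : AdmissibleWeights G A) :
    ∃ α, 0 < α ∧ ∀ k i j, (G k).Adj i j → α ≤ A i j := by
  -- Entries off the links may be nonpositive; the default `1` keeps them from spoiling the minimum.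
  obtain ⟨α, hα, h⟩ := exists_pos_le_of_finite
    (f := fun x : Fin N × Fin N => if 0 < A x.1 x.2 then A x.1 x.2 else 1) (fun x => by
      split_ifs with hx
      exacts [hx, one_pos])
  refine ⟨α, hα, fun k i j hij => ?_⟩
  simpa [hA.2 k i j hij] using h (i, j)

/-- Each weight is nondecreasing and bounded by the energy estimate; its limit is at least its
initial value, so positivity on links survives. -/
theorem IsProtocolSolution.exists_weight_limit {s : ℝ → Fin M} {P : ℝ → Fin N → ℝ}
    {A : ℝ → Fin N → Fin N → ℝ} (h : IsProtocolSolution gen δ β G s P A)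
    (hc : ∀ i, 0 < (gen i).c) (hδ : 0 < δ) (hβ : ∀ i j, 0 < β i j) (hβs : ∀ i j, β i j = β j i)
    {Q : Fin N → ℝ} (hQ : IsOptimalDispatch gen δ D Q) (hP : P 0 ∈ dispatchSet gen D)
    (hA : AdmissibleWeights G (A 0)) :
    ∃ A₁, AdmissibleWeights G A₁ ∧ ∀ i j, Tendsto (fun t => A t i j) atTop (𝓝 (A₁ i j)) := by
  have hsol := h.solutionOn hc hδ hβ hβs hA hP.1
  choose A₁ hlim hle using fun i j => tendsto_of_monotoneOn_Ici_of_le (f := fun t => A t i j)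
    (B := weightBound gen δ β G Q (P 0) (A 0))
    (fun a ha b _ hab => (hsol (b + 1)).weight_mono hβ ha hab (by linarith) i j)
    (fun t ht => (le_abs_self _).trans ((hsol (t + 1)).abs_weight_le hβ hβs hc hδ hQ hP.2 hA
      ⟨ht, by linarith⟩ i j))
  refine ⟨A₁, ⟨fun i j => tendsto_nhds_unique (hlim i j) ((hlim j i).congr' ?_),
    fun k i j hij => (hA.2 k i j hij).trans_le (hle i j)⟩, hlim⟩
  filter_upwards [eventually_ge_atTop 0] with t ht
  exact (hsol (t + 1)).weight_symm hβs hA.1 ⟨ht, by linarith⟩ j i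

theorem continuousAt_energy (γ : ℝ) (θ : Fin N → Fin N → ℝ) {Q : Fin N → ℝ}
    (hQ : WithinLimits gen Q) (A : Fin N → Fin N → ℝ) :
    ContinuousAt (fun x : ProtocolState N => energy gen δ β G γ θ Q x.1 x.2) (Q, A) := by
  refine ContinuousAt.add (ContinuousAt.mul continuousAt_const ?_) ?_
  · have h : ContinuousAt (fun x : ProtocolState N => totalCost gen δ x.1 - totalCost gen δ Q)
        (Q, A) :=
      ((continuousAt_totalCost (P := Q) hQ).comp (f := Prod.fst) (x := (Q, A))
        continuousAt_fst).sub continuousAt_const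
    simpa only [totalCost, ← Finset.sum_sub_distrib] using h
  · refine tendsto_finsetSum _ fun i _ => tendsto_finsetSum _ fun j _ => ?_
    split_ifs
    · exact (by fun_prop : Continuous fun x : ProtocolState N =>
        γ / (4 * β i j) * (θ i j - x.2 i j) ^ 2).continuousAt
    · exact tendsto_const_nhds

/-- Lyapunov stability of the equilibria. -/
theorem exists_stability_radius (hc : ∀ i, 0 < (gen i).c) (hδ : 0 < δ)
    (hβ : ∀ i j, 0 < β i j) (hβs : ∀ i j, β i j = β j i)
    {Q : Fin N → ℝ} (hQ : IsOptimalDispatch gen δ D Q) {A₁ : Fin N → Fin N → ℝ}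
    (hA₁ : AdmissibleWeights G A₁) {ε : ℝ} (hε : 0 < ε) :
    ∃ η : ℝ, 0 < η ∧ ∀ s : ℝ → Fin M, ∀ P A, IsProtocolSolution gen δ β G s P A →
      P 0 ∈ dispatchSet gen D → AdmissibleWeights G (A 0) →
      (∀ i, |P 0 i - Q i| < η) → (∀ i j, |A 0 i j - A₁ i j| < η) →
      ∀ t, 0 ≤ t → (∀ i, |P t i - Q i| < ε) ∧ ∀ i j, |A t i j - A₁ i j| < ε := by
  have hcont := continuousAt_energy (G := G) (δ := δ) (β := β) 1 A₁ hQ.1.1 A₁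
  have hzero : energy gen δ β G 1 A₁ Q Q A₁ = 0 :=
    (energy_eq_zero_iff hβ hc hδ hQ one_pos A₁ hQ.1 A₁).2 ⟨rfl, fun _ _ _ _ => rfl⟩
  have hev : ∀ ρ : ℝ, 0 < ρ → ∀ᶠ x : ProtocolState N in 𝓝 (Q, A₁),
      energy gen δ β G 1 A₁ Q x.1 x.2 < ρ := fun ρ hρ =>
    hcont.eventually (gt_mem_nhds (hzero.trans_lt hρ))
  have hev₁ : ∀ᶠ x : ProtocolState N in 𝓝 (Q, A₁),
      ∀ i, energy gen δ β G 1 A₁ Q x.1 x.2 < (gen i).c * ε ^ 2 :=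
    -- The threshold `c_i ε^2` matches quadratic growth of the cost; `ε^2 / (4 β)` below matches the
    -- weight penalty.
    eventually_all.2 fun i => hev _ (mul_pos (hc i) (by positivity))
  have hev₂ : ∀ᶠ x : ProtocolState N in 𝓝 (Q, A₁),
      ∀ i j, energy gen δ β G 1 A₁ Q x.1 x.2 < 1 / (4 * β i j) * ε ^ 2 :=
    eventually_all.2 fun i => eventually_all.2 fun j => hev _ (by
      have := hβ i j
      positivity)
  obtain ⟨η, hη, hball⟩ := Metric.eventually_nhds_iff.1 (hev₁.and hev₂)
  -- Pairs that are never linked do not enter the energy; their weights stay constant, so they need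
  -- `η ≤ ε`.
  refine ⟨min η ε, lt_min hη hε, fun s P A h hP hA hP₀ hA₀ t ht => ?_⟩
  have hdist : dist ((P 0, A 0) : ProtocolState N) (Q, A₁) < η := by
    refine max_lt ((dist_pi_lt_iff hη).2 fun i => (hP₀ i).trans_le (min_le_left _ _))
      ((dist_pi_lt_iff hη).2 fun i => (dist_pi_lt_iff hη).2 fun j =>
        (hA₀ i j).trans_le (min_le_left _ _))
  obtain ⟨hb₁, hb₂⟩ := hball hdist
  have hsol := h.solutionOn hc hδ hβ hβs hA hP.1 (t + 1)
  have htm : t ∈ Ico 0 (t + 1) := ⟨ht, by linarith⟩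
  have hPt : P t ∈ dispatchSet gen D :=
    ⟨hsol.withinLimits t htm, (hsol.sum_power hβs hA.1 htm).trans hP.2⟩
  have he := hsol.energy_le hβ hβs hA.1 (γ := 1) zero_le_one (θ := A₁)
    (fun k i j hij => (hA₁.2 k i j hij).le) Q htm
  obtain ⟨-, hl₁, hl₂⟩ := energy_lower_bounds (G := G) hβ hc hδ hQ zero_le_one A₁ hPt (A t)
  refine ⟨fun i => ?_, fun i j => ?_⟩
  · have h₁ := Finset.single_le_sum (f := fun i => (gen i).c * (P t i - Q i) ^ 2)
      (fun i _ => mul_nonneg (hc i).le (sq_nonneg _)) (Finset.mem_univ i)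
    have h₂ := h₁.trans (hQ.quadratic_growth hδ hPt)
    rw [one_mul] at hl₁
    have h₃ := lt_of_mul_lt_mul_left (((h₂.trans hl₁).trans he).trans_lt (hb₁ i)) (hc i).le
    exact abs_lt_of_sq_lt_sq h₃ hε.le
  · by_cases hij : ∃ k, (G k).Adj i j
    · obtain ⟨k, hk⟩ := hij
      have hβ' := hβ i j
      have h₃ := lt_of_mul_lt_mul_left (((hl₂ k i j hk).trans he).trans_lt (hb₂ i j))
        (by positivity)
      rw [abs_sub_comm]
      exact abs_lt_of_sq_lt_sq h₃ hε.le
    · push Not at hij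
      rw [hsol.weight_eq htm hij]
      exact (hA₀ i j).trans_le (min_le_right _ _)

end Decay

/-! ### Assembly of the theorem -/

theorem theorem4 {N M : ℕ} (gen : Fin N → Generator) (δ D : ℝ) (β : Fin N → Fin N → ℝ)
    (G : Fin M → SimpleGraph (Fin N))
    (hc : ∀ i, 0 < (gen i).c) (hδ : 0 < δ)
    (hβ : ∀ i j, 0 < β i j) (hβ_symm : ∀ i j, β i j = β j i)
    (hG : ∀ k, (G k).Connected)
    (hD : (dispatchSet gen D).Nonempty) :
    -- the dispatch problem has a unique solution
    ∃ Q : Fin N → ℝ, IsOptimalDispatch gen δ D Q ∧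
      (∀ Q', IsOptimalDispatch gen δ D Q' → Q' = Q) ∧
      -- the switched protocol has a unique global solution for all initial data
      (∀ s : ℝ → Fin M, IsSwitchingSignal s →
        ∀ P₀ ∈ dispatchSet gen D, ∀ A₀, AdmissibleWeights G A₀ →
        ∃ P A, (IsProtocolSolution gen δ β G s P A ∧ P 0 = P₀ ∧ A 0 = A₀) ∧
          ∀ P' A', IsProtocolSolution gen δ β G s P' A' → P' 0 = P₀ → A' 0 = A₀ →
            ∀ t, 0 ≤ t → P' t = P t ∧ A' t = A t) ∧
      -- balance and limits at all times, consensus, convergence to the optimum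
      (∀ s : ℝ → Fin M, IsSwitchingSignal s → ∀ P A, IsProtocolSolution gen δ β G s P A →
        P 0 ∈ dispatchSet gen D → AdmissibleWeights G (A 0) →
        (∀ t, 0 ≤ t → P t ∈ dispatchSet gen D) ∧
        (∀ i j, Tendsto (fun t => incCost gen δ (P t) i - incCost gen δ (P t) j)
          atTop (𝓝 0)) ∧
        (∀ i, Tendsto (fun t => P t i) atTop (𝓝 (Q i))) ∧
        ∃ A₁, AdmissibleWeights G A₁ ∧
          ∀ i j, Tendsto (fun t => A t i j) atTop (𝓝 (A₁ i j))) ∧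
      -- Lyapunov stability, uniform in the switching signal
      (∀ A₁, AdmissibleWeights G A₁ → ∀ ε : ℝ, 0 < ε → ∃ η : ℝ, 0 < η ∧
        ∀ s : ℝ → Fin M, IsSwitchingSignal s → ∀ P A, IsProtocolSolution gen δ β G s P A →
        P 0 ∈ dispatchSet gen D → AdmissibleWeights G (A 0) →
        (∀ i, |P 0 i - Q i| < η) → (∀ i j, |A 0 i j - A₁ i j| < η) →
        ∀ t, 0 ≤ t → (∀ i, |P t i - Q i| < ε) ∧ ∀ i j, |A t i j - A₁ i j| < ε) ∧
      -- exponential stability of the consensus error, uniform in the switching signal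
      (∀ μ : ℝ, 0 < μ → ∀ α : ℝ, 0 < α → ∃ K : ℝ, 0 < K ∧ ∃ r : ℝ, 0 < r ∧
        ∀ s : ℝ → Fin M, IsSwitchingSignal s → ∀ P A, IsProtocolSolution gen δ β G s P A →
        P 0 ∈ dispatchSet gen D → AdmissibleWeights G (A 0) →
        (∀ i, (gen i).pmin + μ ≤ P 0 i ∧ P 0 i ≤ (gen i).pmax - μ) →
        (∀ k i j, (G k).Adj i j → α ≤ A 0 i j) →
        ∀ t, 0 ≤ t → ‖WithLp.toLp 2 (consensusError gen δ (P t))‖ ≤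
          K * Real.exp (-r * t) * ‖WithLp.toLp 2 (consensusError gen δ (P 0))‖) ∧
      -- a common Lyapunov function for all modes
      (∀ (γ θ₀ : ℝ) (θ : Fin N → Fin N → ℝ), 0 < γ → 0 < θ₀ → (∀ i j, θ i j = θ j i) →
        (∀ k i j, (G k).Adj i j → θ₀ ≤ θ i j) →
        (∀ P ∈ dispatchSet gen D, ∀ A, 0 ≤ energy gen δ β G γ θ Q P A ∧
          (energy gen δ β G γ θ Q P A = 0 ↔
            P = Q ∧ ∀ k i j, (G k).Adj i j → A i j = θ i j)) ∧
        ∀ s : ℝ → Fin M, IsSwitchingSignal s → ∀ P A, IsProtocolSolution gen δ β G s P A →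
        P 0 ∈ dispatchSet gen D → AdmissibleWeights G (A 0) → ∀ t, 0 ≤ t →
        ∃ v : ℝ, HasDerivWithinAt (fun τ => energy gen δ β G γ θ Q (P τ) (A τ)) v (Ici t) t ∧
          v ≤ -γ * θ₀ * laplacianForm (G (s t)) (consensusError gen δ (P t)) ∧
          -γ * θ₀ * laplacianForm (G (s t)) (consensusError gen δ (P t)) ≤ 0) := by
  obtain ⟨Q, hQ⟩ := exists_isOptimalDispatch hc hδ hD
  refine ⟨Q, hQ, fun Q' hQ' => hQ.unique hc hδ hQ', ?_, ?_, ?_, ?_, ?_⟩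
  · intro s hs P₀ hP₀ A₀ hA₀
    exact exists_unique_protocolSolution hc hδ hβ hβ_symm hQ hs hP₀ hA₀
  · intro s _ P A h hP hA
    -- For a single solution, its own initial weights and initial cost serve as the uniform bounds.
    obtain ⟨α, hα, hαA⟩ := hA.exists_lower_bound
    obtain ⟨K, hK, r, hr, hdecay⟩ :=
      exists_exponential_decay hc hδ hβ hβ_symm hG hQ (totalCost gen δ (P 0)) hα
    have hd := hdecay s P A h hP hA le_rfl hαA
    refine ⟨fun t ht => (hd t ht).1, fun i j => ?_, fun i => ?_,
      h.exists_weight_limit hc hδ hβ hβ_symm hQ hP hA⟩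
    · have hlim : ∀ i, Tendsto (fun t => consensusError gen δ (P t) i) atTop (𝓝 0) := fun i => by
        refine tendsto_zero_of_mul_sq_le_exp (a := K * excessCost gen δ Q (P 0)) one_pos hr
          fun t ht => ?_
        obtain ⟨-, h₁, h₂, -⟩ := hd t ht
        have h₃ := Finset.single_le_sum (f := fun i => consensusError gen δ (P t) i ^ 2)
          (fun i _ => sq_nonneg _) (Finset.mem_univ i)
        have h₄ := mul_le_mul_of_nonneg_left h₁ hK.le
        rw [one_mul]
        calc _ ≤ _ := h₃.trans (h₂.trans h₄)
          _ = _ := by ring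
      simpa [consensusError_sub] using (hlim i).sub (hlim j)
    · refine tendsto_sub_nhds_zero_iff.1 (tendsto_zero_of_mul_sq_le_exp
        (a := excessCost gen δ Q (P 0)) (hc i) hr fun t ht => ?_)
      obtain ⟨hm, h₁, -, -⟩ := hd t ht
      have h₃ := Finset.single_le_sum (f := fun i => (gen i).c * (P t i - Q i) ^ 2)
        (fun i _ => mul_nonneg (hc i).le (sq_nonneg _)) (Finset.mem_univ i)
      calc _ ≤ _ := h₃.trans ((hQ.quadratic_growth hδ hm).trans h₁)
        _ = _ := mul_comm _ _
  · intro A₁ hA₁ ε hε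
    obtain ⟨η, hη, h⟩ := exists_stability_radius hc hδ hβ hβ_symm hQ hA₁ hε
    exact ⟨η, hη, fun s _ => h s⟩
  · intro μ hμ α hα
    obtain ⟨E, hE⟩ := exists_totalCost_bound gen δ hμ
    obtain ⟨K, hK, r, hr, hdecay⟩ := exists_exponential_decay hc hδ hβ hβ_symm hG hQ E hα
    -- The rate `r` concerns squares, hence `r / 2`. The equivalence constant enters twice, as
    -- `K^2`, and its root is `K`.
    refine ⟨K, hK, r / 2, by positivity, fun s _ P A h hP hA hμP hαA t ht => ?_⟩
    obtain ⟨-, h₁, h₂, -⟩ := hdecay s P A h hP hA (hE _ hμP) hαA t ht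
    obtain ⟨-, -, -, h₃⟩ := hdecay s P A h hP hA (hE _ hμP) hαA 0 le_rfl
    refine le_of_sq_le_sq ?_ (by positivity)
    rw [mul_pow, mul_pow, EuclideanSpace.real_norm_sq_eq, EuclideanSpace.real_norm_sq_eq,
      ← Real.exp_nat_mul]
    calc _ ≤ K * (Real.exp (-r * t) * (K * ∑ i, consensusError gen δ (P 0) i ^ 2)) :=
          h₂.trans (mul_le_mul_of_nonneg_left (h₁.trans
            (mul_le_mul_of_nonneg_left h₃ (Real.exp_pos _).le)) hK.le)
      _ = _ := by
        rw [show ((2 : ℕ) : ℝ) * (-(r / 2) * t) = -r * t by push_cast; ring]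
        ring
  · intro γ θ₀ θ hγ hθ₀ _ hθ
    refine ⟨fun P hP A => ⟨(energy_lower_bounds hβ hc hδ hQ hγ.le θ hP A).1,
      energy_eq_zero_iff hβ hc hδ hQ hγ θ hP A⟩, fun s _ P A h hP hA t ht => ?_⟩
    have hsol := h.solutionOn hc hδ hβ hβ_symm hA hP.1 (t + 1)
    refine ⟨_, hsol.energy_deriv hβ hβ_symm hA.1 γ θ Q ⟨ht, by linarith⟩, ?_, ?_⟩
    · rw [laplacianForm_eq]
      simp only [consensusError_sub]
      have h₁ := linkSum_le_linkSum (H := G (s t))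
        (f := fun i j => θ₀ * (incCost gen δ (P t) i - incCost gen δ (P t) j) ^ 2)
        (g := fun i j => θ i j * (incCost gen δ (P t) i - incCost gen δ (P t) j) ^ 2)
        fun i j hij => mul_le_mul_of_nonneg_right (hθ _ i j hij) (sq_nonneg _)
      rw [linkSum_const_mul] at h₁
      nlinarith
    · rw [laplacianForm_eq]
      have h₁ := linkSum_nonneg (H := G (s t)) (f := fun i j =>
        (consensusError gen δ (P t) i - consensusError gen δ (P t) j) ^ 2)
        fun i j _ => sq_nonneg _
      have : 0 ≤ γ * θ₀ * (linkSum (G (s t)) (fun i j =>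
        (consensusError gen δ (P t) i - consensusError gen δ (P t) j) ^ 2) / 2) := by positivity
      linarith
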